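/- Let $p$ be a prime, $G$ a finite group and $S$ a Sylow $p$-subgroup of $G$. Let $\mathcal C$ be a collection of $p$-subgroups of $G$, i.e. a set of $p$-subgroups closed under $G$-conjugation, regarded as a poset under inclusion on which $G$ acts by conjugation. Let $E\mathbf O_{\mathcal C}$ be the category whose objects are the pairs $(G/H,x)$ with $H\in\mathcal C$ and $x\in G/H$, and whose morphisms $(G/H,x)\to(G/H',x')$ are the $G$-maps $G/H\to G/H'$ sending $x$ to $x'$; $G$ acts by $g\cdot(G/H,x)=(G/H,gx)$. Let $E\mathbf A_{\mathcal C}$ be the category whose objects are the monomorphisms $i\colon H\to G$ with $H\in\mathcal C$ and $i(H)\in\mathcal C$, and whose morphisms from $i\colon H\to G$ to $i'\colon H'\to G$ are the homomorphisms $\varphi\colon H\to H'$ with $i'\circ\varphi=i$; $G$ acts by composing $i$ with conjugation, $(g\cdot i)(h)=g\,i(h)\,g^{-1}$. Write $|\cdot|$ for the geometric realization of the nerve. A map of $S$-spaces is an $S$-homotopy equivalence if it is $S$-equivariant and has an $S$-equivariant homotopy inverse, with both homotopies through $S$-equivariant maps. 1. Suppose that $\mathcal C$ is closed under passage to $p$-overgroups: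 if $Q\in\mathcal C$ and $P\ge Q$ is a $p$-subgroup of $G$, then $P\in\mathcal C$. Then the canonical functor $E\mathbf O_{\mathcal C}\to\mathcal C$, $(G/H,x)\mapsto G_x$ (the stabilizer of $x$), induces an $S$-homotopy equivalence $|E\mathbf O_{\mathcal C}|\to|\mathcal C|$. 2. Suppose that $\mathcal C$ is closed under passage to nontrivial subgroups: if $Q\in\mathcal C$ and $1\ne P\le Q$, then $P\in\mathcal C$. Then the canonical functor $E\mathbf A_{\mathcal C}\to\mathcal C$, $(i\colon H\to G)\mapsto i(H)$, induces an $S$-homotopy equivalence $|E\mathbf A_{\mathcal C}|\to|\mathcal C|$. The same holds if $E\mathbf A_{\mathcal C}$ is replaced by its full subcategory on those $i$ that are induced by conjugation in $G$. -/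

import Mathlib

open CategoryTheory

universe v u

section EquivariantHomotopy

/-- A continuous map `f : X → Y` between `K`-spaces is a `K`-homotopy equivalence: it is
`K`-equivariant and has a `K`-equivariant homotopy inverse, the two homotopies being
through `K`-equivariant maps. -/
def IsEquivariantHomotopyEquiv (K : Type*) [Group K] {X Y : Type*}
    [TopologicalSpace X] [TopologicalSpace Y] [MulAction K X] [MulAction K Y]
    (f : C(X, Y)) : Prop :=
  (∀ (k : K) (x : X), f (k • x) = k • f x) ∧
  ∃ f' : C(Y, X), (∀ (k : K) (y : Y), f' (k • y) = k • f' y) ∧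
    (∃ F : (f'.comp f).Homotopy (ContinuousMap.id X),
      ∀ (t : unitInterval) (k : K) (x : X), F (t, k • x) = k • F (t, x)) ∧
    (∃ F : (f.comp f').Homotopy (ContinuousMap.id Y),
      ∀ (t : unitInterval) (k : K) (y : Y), F (t, k • y) = k • F (t, y))

end EquivariantHomotopy

section Nerves

/-- A (strict) left action of a group `G` on a category `A` by functors. -/
class StrictAction (G : Type*) [Group G] (A : Type u) [Category.{v} A] where
  act : G → A ⥤ A
  act_one : act 1 = 𝟭 A
  act_mul : ∀ g h : G, act (g * h) = act h ⋙ act g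

/-- The underlying space of the geometric realization `|A|` of the nerve of a category `A`. -/
abbrev NerveSpace (A : Type u) [Category.{v} A] : Type (max u v) :=
  (SSet.toTop.obj (nerve A) : TopCat.{max u v})

/-- The continuous map `|F| : |A| → |B|` induced by a functor `F : A ⥤ B`. -/
noncomputable def nerveSpaceMap {A B : Type u} [Category.{v} A] [Category.{v} B] (F : A ⥤ B) :
    C(NerveSpace A, NerveSpace B) :=
  (SSet.toTop.map (nerveMap F)).hom

theorem nerveSpaceMap_id (A : Type u) [Category.{v} A] :
    nerveSpaceMap (𝟭 A) = ContinuousMap.id (NerveSpace A) := by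
  have h : nerveMap (𝟭 A) = 𝟙 (nerve A) := rfl
  simp only [nerveSpaceMap, h, SSet.toTop.map_id]
  rfl

theorem nerveSpaceMap_comp {A B D : Type u} [Category.{v} A] [Category.{v} B] [Category.{v} D]
    (F : A ⥤ B) (F' : B ⥤ D) :
    nerveSpaceMap (F ⋙ F') = (nerveSpaceMap F').comp (nerveSpaceMap F) := by
  have h : nerveMap (F ⋙ F') = nerveMap F ≫ nerveMap F' := rfl
  simp only [nerveSpaceMap, h, SSet.toTop.map_comp]
  rfl

/-- An action of `G` on a category `A` induces an action of `G` on the space `|A|`. -/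
noncomputable instance nerveSpaceMulAction (G : Type*) [Group G] (A : Type u) [Category.{v} A]
    [StrictAction G A] : MulAction G (NerveSpace A) where
  smul g x := nerveSpaceMap (StrictAction.act (A := A) g) x
  one_smul x := by
    change nerveSpaceMap (StrictAction.act (A := A) (1 : G)) x = x
    rw [StrictAction.act_one, nerveSpaceMap_id]
    rfl
  mul_smul g h x := by
    change nerveSpaceMap (StrictAction.act (A := A) (g * h)) x =
      nerveSpaceMap (StrictAction.act (A := A) g) (nerveSpaceMap (StrictAction.act (A := A) h) x)
    rw [StrictAction.act_mul, nerveSpaceMap_comp]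
    rfl

end Nerves

/-- A collection of subgroups of `G`: a set of subgroups closed under `G`-conjugation. -/
structure SubgroupCollection (G : Type u) [Group G] where
  carrier : Set (Subgroup G)
  conj_mem : ∀ (g : G) (Q : Subgroup G), Q ∈ carrier →
    Q.map (MulAut.conj g).toMonoidHom ∈ carrier

namespace SubgroupCollection

variable {G : Type u} [Group G] (C : SubgroupCollection G)

/-- The poset of members of the collection, ordered by inclusion, regarded as a category. -/
abbrev Elem : Type u := {Q : Subgroup G // Q ∈ C.carrier}

/-- The conjugation action `Q ↦ g Q g⁻¹` of `G` on the poset of members of the collection. -/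
instance elemAction : StrictAction G C.Elem where
  act g := Monotone.functor
    (f := fun Q : C.Elem => (⟨_, C.conj_mem g Q.1 Q.2⟩ : C.Elem))
    (fun _ _ h => Subgroup.map_mono h)
  act_one := CategoryTheory.Functor.ext
    (fun Q => Subtype.ext (by ext x; simp [Monotone.functor, Subgroup.mem_map]))
    (fun _ _ _ => Subsingleton.elim _ _)
  act_mul g h := CategoryTheory.Functor.ext
    (fun Q => Subtype.ext (by
      simp only [Monotone.functor, Functor.comp_obj, Subgroup.map_map]
      congr 1
      ext x
      simp))
    (fun _ _ _ => Subsingleton.elim _ _)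

/-- Objects of `EO_C`: pairs `(G/H, x)` with `H ∈ C` and `x ∈ G/H`. -/
structure EO where
  sub : Subgroup G
  sub_mem : sub ∈ C.carrier
  pt : G ⧸ sub

/-- Morphisms `(G/H, x) → (G/H', x')` in `EO_C`: the `G`-maps `G/H → G/H'` sending `x` to `x'`. -/
instance : Category.{u} C.EO where
  Hom X Y := {f : (G ⧸ X.sub) →[G] (G ⧸ Y.sub) // f X.pt = Y.pt}
  id X := ⟨MulActionHom.id G, rfl⟩
  comp f f' := ⟨f'.1.comp f.1, by rw [MulActionHom.comp_apply, f.2, f'.2]⟩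

instance (X Y : C.EO) : Subsingleton (X ⟶ Y) :=
  ⟨fun f f' => Subtype.ext (MulActionHom.ext fun z => by
    obtain ⟨g, rfl⟩ := MulAction.exists_smul_eq G X.pt z
    rw [map_smul, map_smul, f.2, f'.2])⟩

/-- The action `g • (G/H, x) = (G/H, g x)` of `G` on `EO_C`. -/
instance eoAction : StrictAction G C.EO where
  act g :=
    { obj := fun X => ⟨X.sub, X.sub_mem, g • X.pt⟩
      map := fun {X Y} f => ⟨f.1, (map_smul f.1 g X.pt).trans (congrArg (g • ·) f.2)⟩
      map_id := fun _ => rfl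
      map_comp := fun _ _ => rfl }
  act_one := CategoryTheory.Functor.ext
    (fun X => by
      obtain ⟨Q, hQ, x⟩ := X
      simp)
    (fun _ _ _ => Subsingleton.elim _ _)
  act_mul g h := CategoryTheory.Functor.ext
    (fun X => by
      obtain ⟨Q, hQ, x⟩ := X
      simp [mul_smul])
    (fun _ _ _ => Subsingleton.elim _ _)

/-- The stabilizer of a point of `G/H` is a conjugate of `H`. -/
theorem stabilizer_mem (X : C.EO) : MulAction.stabilizer G X.pt ∈ C.carrier := by
  obtain ⟨Q, hQ, x⟩ := X
  obtain ⟨g, rfl⟩ := QuotientGroup.mk_surjective x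
  have h : MulAction.stabilizer G (g : G ⧸ Q) = Q.map (MulAut.conj g).toMonoidHom := by
    have h1 : (g : G ⧸ Q) = g • ((1 : G) : G ⧸ Q) := by
      rw [MulAction.Quotient.smul_coe, smul_eq_mul, mul_one]
    rw [h1, MulAction.stabilizer_smul_eq_stabilizer_map_conj, MulAction.stabilizer_quotient]
  change MulAction.stabilizer G (g : G ⧸ Q) ∈ C.carrier
  rw [h]
  exact C.conj_mem g Q hQ

/-- The canonical functor `EO_C → C`, `(G/H, x) ↦ G_x`. -/
def eoFunctor : C.EO ⥤ C.Elem where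
  obj X := ⟨MulAction.stabilizer G X.pt, C.stabilizer_mem X⟩
  map {X Y} f := homOfLE (Subtype.coe_le_coe.mp fun g (hg : g • X.pt = X.pt) =>
    show g • Y.pt = Y.pt by rw [← f.2, ← map_smul, hg])

/-- Objects of `EA_C`: monomorphisms `i : H → G` with `H ∈ C` and image in `C`. -/
structure EA where
  dom : Subgroup G
  dom_mem : dom ∈ C.carrier
  mono : dom →* G
  injective : Function.Injective mono
  range_mem : mono.range ∈ C.carrier

theorem EA.mk_congr {Q : Subgroup G} {hQ : Q ∈ C.carrier} {i i' : Q →* G}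
    {hi : Function.Injective i} {hi' : Function.Injective i'}
    {hr : i.range ∈ C.carrier} {hr' : i'.range ∈ C.carrier} (h : i = i') :
    (⟨Q, hQ, i, hi, hr⟩ : C.EA) = ⟨Q, hQ, i', hi', hr'⟩ := by
  subst h
  rfl

/-- Morphisms from `i : H → G` to `i' : H' → G` in `EA_C`: the homomorphisms `φ : H → H'` such
that `i` is `φ` followed by `i'`. -/
instance : Category.{u} C.EA where
  Hom X Y := {φ : X.dom →* Y.dom // Y.mono.comp φ = X.mono}
  id X := ⟨MonoidHom.id _, rfl⟩
  comp φ ψ := ⟨ψ.1.comp φ.1, by rw [← MonoidHom.comp_assoc, ψ.2, φ.2]⟩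

instance (X Y : C.EA) : Subsingleton (X ⟶ Y) :=
  ⟨fun φ ψ => Subtype.ext (MonoidHom.ext fun z => Y.injective (by
    have h := φ.2.trans ψ.2.symm
    exact DFunLike.congr_fun h z))⟩

/-- The action of `G` on `EA_C`: `g • i` is `i` followed by conjugation `x ↦ g x g⁻¹`. -/
instance eaAction : StrictAction G C.EA where
  act g :=
    { obj := fun X =>
        { dom := X.dom
          dom_mem := X.dom_mem
          mono := (MulAut.conj g).toMonoidHom.comp X.mono
          injective := (MulAut.conj g).injective.comp X.injective
          range_mem := by
            rw [MonoidHom.range_comp]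
            exact C.conj_mem g _ X.range_mem }
      map := fun {X Y} φ => ⟨φ.1, by
        rw [MonoidHom.comp_assoc, φ.2]⟩
      map_id := fun _ => rfl
      map_comp := fun _ _ => rfl }
  act_one := CategoryTheory.Functor.ext
    (fun X => by
      refine EA.mk_congr C (MonoidHom.ext fun x => ?_)
      simp)
    (fun _ _ _ => Subsingleton.elim _ _)
  act_mul g h := CategoryTheory.Functor.ext
    (fun X => by
      refine EA.mk_congr C (MonoidHom.ext fun x => ?_)
      simp [mul_assoc])
    (fun _ _ _ => Subsingleton.elim _ _)

/-- The canonical functor `EA_C → C`, `(i : H → G) ↦ i(H)`. -/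
def eaFunctor : C.EA ⥤ C.Elem where
  obj X := ⟨X.mono.range, X.range_mem⟩
  map {X Y} φ := homOfLE (Subtype.coe_le_coe.mp (by
    change X.mono.range ≤ Y.mono.range
    rw [← φ.2]
    rintro _ ⟨z, rfl⟩
    exact ⟨φ.1 z, rfl⟩))

/-- The monomorphisms `i : H → G` that are induced by conjugation in `G`. -/
def conjInduced : ObjectProperty C.EA :=
  fun X => ∃ g : G, ∀ h : X.dom, X.mono h = g * (h : G) * g⁻¹

/-- The full subcategory of `EA_C` on the monomorphisms induced by conjugation in `G`. -/
abbrev EAConj : Type u := C.conjInduced.FullSubcategory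

instance (X Y : C.EAConj) : Subsingleton (X ⟶ Y) :=
  ⟨fun _ _ => ObjectProperty.hom_ext _ (Subsingleton.elim _ _)⟩

/-- The restriction of the action of `G` on `EA_C`. -/
instance eaConjAction : StrictAction G C.EAConj where
  act g := C.conjInduced.lift (C.conjInduced.ι ⋙ StrictAction.act (A := C.EA) g) (fun X => by
    obtain ⟨g', hg'⟩ := X.property
    refine ⟨g * g', fun h => ?_⟩
    change g * X.obj.mono h * g⁻¹ = _
    rw [hg']
    simp [mul_assoc])
  act_one := CategoryTheory.Functor.ext
    (fun X => by
      have h : (StrictAction.act (A := C.EA) (1 : G)).obj X.obj = X.obj := by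
        rw [StrictAction.act_one]; rfl
      exact ObjectProperty.FullSubcategory.ext h)
    (fun _ _ _ => Subsingleton.elim _ _)
  act_mul g g' := CategoryTheory.Functor.ext
    (fun X => by
      have h : (StrictAction.act (A := C.EA) (g * g')).obj X.obj =
          (StrictAction.act (A := C.EA) g).obj ((StrictAction.act (A := C.EA) g').obj X.obj) := by
        rw [StrictAction.act_mul]; rfl
      exact ObjectProperty.FullSubcategory.ext h)
    (fun _ _ _ => Subsingleton.elim _ _)

/-- The canonical functor to `C` on monomorphisms induced by conjugation, `i ↦ i(H)`. -/
def eaConjFunctor : C.EAConj ⥤ C.Elem := C.conjInduced.ι ⋙ C.eaFunctor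

end SubgroupCollection

/-! All categories here are preorders, and each functor `F` to the collection preserves and reflects
the order. Forgetting the action, every member `Q` of the collection has an evident preimage: the
coset `1·Q`, or the inclusion of `Q`. The obstruction is equivariance: `N_S(Q)` stabilizes `Q`, but
an object of `EO_C` over `Q` is fixed only by `Q`, and one of `EA_C` only by the centralizer of `Q`.

The cure is to pass to the barycentric subdivision, whose vertices are chains `τ`, and to send `τ`
to a member `d(τ)` with a preimage fixed by the stabilizer of `τ` in `S`. Since conjugation
preserves orders of subgroups, this stabilizer is the common normalizer `N_S(τ)`. In part 1 take
`d(τ) = N_S(τ)·Q` with `Q` the least member of `τ`; it is a `p`-group above `Q`, and its trivial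
coset is fixed by `N_S(τ)`. In part 2 take `d(τ) = Q ∩ C_G(N_S(τ))` with `Q` the largest member; it
is nontrivial if `Q` is, because a `p`-group acting on a nontrivial `p`-group has a nontrivial fixed
point, and its inclusion into `G` is fixed by `N_S(τ)`. In the order of `C` (reversed for part 2),
`d` is monotone for reverse inclusion of chains and lies above the least element of the chain.

Choosing preimages orbit by orbit makes the lift `c` of `d` equivariant and yields `g : |C| → |sd C|
→ |A|`. Both composites of `g` with `|F|` are again subdivision maps, and
`IsSubdivisionMap.exists_homotopy` joins each to the identity: move linearly to the subdivision with
`τ` placed at its least element, then push that element up to `c(τ)`. Everything is given by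
explicit barycentric weights that are invariant under face maps and automorphisms, so gluing and
equivariance follow from one uniqueness principle, `IsWeightedPoint.eq_of_map`. -/

/-! ### Points of a realization and maps out of it -/

section RealizationPoints

/-- The point of `|X|` with barycentric coordinates `t` in the simplex `x`. -/
noncomputable def realizationPoint (X : SSet.{u}) {n : SimplexCategory}
    (x : X.obj (Opposite.op n)) : C(stdSimplex ℝ (Fin (n.len + 1)), SSet.toTop.obj X) :=
  TopCat.toSSetObjEquiv _ _ ((sSetTopAdj.unit.app X).app (Opposite.op n) x)

theorem toSSetObjEquiv_map (T : TopCat.{u}) {m n : SimplexCategory} (θ : m ⟶ n)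
    (x : (TopCat.toSSet.obj T).obj (Opposite.op n)) (t : stdSimplex ℝ (Fin (m.len + 1))) :
    TopCat.toSSetObjEquiv T (Opposite.op m) ((TopCat.toSSet.obj T).map θ.op x) t =
      TopCat.toSSetObjEquiv T (Opposite.op n) x (stdSimplex.map θ t) := by
  rfl

theorem toSSetObjEquiv_app {T T' : TopCat.{u}} (g : T ⟶ T') {n : SimplexCategory}
    (x : (TopCat.toSSet.obj T).obj (Opposite.op n)) (t : stdSimplex ℝ (Fin (n.len + 1))) :
    TopCat.toSSetObjEquiv T' (Opposite.op n) ((TopCat.toSSet.map g).app _ x) t =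
      g (TopCat.toSSetObjEquiv T (Opposite.op n) x t) := by
  rfl

theorem realizationPoint_map (X : SSet.{u}) {m n : SimplexCategory} (θ : m ⟶ n)
    (x : X.obj (Opposite.op n)) (t : stdSimplex ℝ (Fin (m.len + 1))) :
    realizationPoint X (X.map θ.op x) t = realizationPoint X x (stdSimplex.map θ t) := by
  have h := congrArg (fun f => f x) ((sSetTopAdj.unit.app X).naturality θ.op)
  unfold realizationPoint
  rw [← toSSetObjEquiv_map]
  exact DFunLike.congr_fun (congrArg (TopCat.toSSetObjEquiv _ (Opposite.op m)) h) t

theorem toTop_map_realizationPoint {X Y : SSet.{u}} (φ : X ⟶ Y) {n : SimplexCategory}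
    (x : X.obj (Opposite.op n)) (t : stdSimplex ℝ (Fin (n.len + 1))) :
    SSet.toTop.map φ (realizationPoint X x t) = realizationPoint Y (φ.app _ x) t := by
  have h := sSetTopAdj.unit.naturality φ
  have h2 := congrArg (fun f => f.app (Opposite.op n) x) h
  unfold realizationPoint
  rw [← toSSetObjEquiv_app]
  exact (DFunLike.congr_fun (congrArg (TopCat.toSSetObjEquiv _ (Opposite.op n)) h2) t).symm

/-- By adjunction a map out of `|X|` is a simplicial map from `X` to the singular set of the target,
hence is known from its values on the points of simplices. -/
theorem realization_hom_ext {X : SSet.{u}} {T : TopCat.{u}} {f g : SSet.toTop.obj X ⟶ T}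
    (h : ∀ (n : SimplexCategory) (x : X.obj (Opposite.op n)) (t : stdSimplex ℝ (Fin (n.len + 1))),
      f (realizationPoint X x t) = g (realizationPoint X x t)) : f = g := by
  apply (sSetTopAdj.homEquiv X T).injective
  ext n x
  induction n using Opposite.rec with | op n => ?_
  apply (TopCat.toSSetObjEquiv T (Opposite.op n)).injective
  ext t
  rw [sSetTopAdj.homEquiv_unit, sSetTopAdj.homEquiv_unit]
  exact h n x t

/-- A family compatible with all simplicial operators is a simplicial map into the singular set; its
adjoint is the glued map. -/
theorem exists_realization_desc {X : SSet.{u}} {T : TopCat.{u}}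
    (F : ∀ n : SimplexCategory, X.obj (Opposite.op n) → C(stdSimplex ℝ (Fin (n.len + 1)), T))
    (hF : ∀ (m n : SimplexCategory) (θ : m ⟶ n) (x : X.obj (Opposite.op n))
      (t : stdSimplex ℝ (Fin (m.len + 1))),
        F m (X.map θ.op x) t = F n x (stdSimplex.map θ t)) :
    ∃ g : SSet.toTop.obj X ⟶ T, ∀ (n : SimplexCategory) (x : X.obj (Opposite.op n))
      (t : stdSimplex ℝ (Fin (n.len + 1))), g (realizationPoint X x t) = F n x t := by
  let φ : X ⟶ TopCat.toSSet.obj T :=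
    { app := fun n => TypeCat.ofHom fun x => (TopCat.toSSetObjEquiv T n).symm (F n.unop x)
      naturality := by
        intro n m θ
        ext x
        apply (TopCat.toSSetObjEquiv T m).injective
        ext t
        have h1 := hF m.unop n.unop θ.unop x t
        have h2 := toSSetObjEquiv_map T θ.unop ((TopCat.toSSetObjEquiv T n).symm (F n.unop x)) t
        rw [Equiv.apply_symm_apply] at h2
        simp
        exact h1.trans h2.symm }
  refine ⟨(sSetTopAdj.homEquiv X T).symm φ, fun n x t => ?_⟩
  have h := (sSetTopAdj.homEquiv_unit (f := (sSetTopAdj.homEquiv X T).symm φ))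
  rw [Equiv.apply_symm_apply] at h
  unfold realizationPoint
  rw [← toSSetObjEquiv_app]
  have h2 := congrArg (fun f => f.app (Opposite.op n) x) h
  have h3 := DFunLike.congr_fun (congrArg (TopCat.toSSetObjEquiv _ (Opposite.op n)) h2) t
  refine h3.symm.trans ?_
  change TopCat.toSSetObjEquiv T (Opposite.op n)
    ((TopCat.toSSetObjEquiv T (Opposite.op n)).symm (F n x)) t = _
  rw [Equiv.apply_symm_apply]

variable {A : Type u} [Category.{u} A]

/-- A finite sequence of objects, each of which maps to the later ones. -/
def IsObjChain {n : ℕ} (a : Fin (n + 1) → A) : Prop :=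
  ∀ i j, i ≤ j → Nonempty (a i ⟶ a j)

theorem IsObjChain.comp {m n : ℕ} {a : Fin (n + 1) → A} (h : IsObjChain a)
    {θ : Fin (m + 1) → Fin (n + 1)} (hθ : Monotone θ) : IsObjChain (a ∘ θ) :=
  fun _ _ hij => h _ _ (hθ hij)

theorem IsObjChain.map {n : ℕ} {a : Fin (n + 1) → A} (h : IsObjChain a)
    {B : Type u} [Category.{u} B] (F : A ⥤ B) : IsObjChain (F.obj ∘ a) :=
  fun i j hij => (h i j hij).map F.map

variable [Quiver.IsThin A]

/-- The simplex of the nerve of a thin category given by a chain of objects. -/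
noncomputable def IsObjChain.functor {n : ℕ} {a : Fin (n + 1) → A} (h : IsObjChain a) :
    Fin (n + 1) ⥤ A where
  obj := a
  map f := (h _ _ (leOfHom f)).some
  map_id _ := Subsingleton.elim _ _
  map_comp _ _ := Subsingleton.elim _ _

/-- The point with barycentric coordinates `t` in the simplex of `|A|` given by a chain `a`. -/
noncomputable def chainPoint {n : ℕ} {a : Fin (n + 1) → A} (h : IsObjChain a) :
    C(stdSimplex ℝ (Fin (n + 1)), NerveSpace A) :=
  realizationPoint (nerve A) (n := SimplexCategory.mk n) h.functor

theorem chainPoint_comp {m n : ℕ} {a : Fin (n + 1) → A} (h : IsObjChain a)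
    {θ : Fin (m + 1) → Fin (n + 1)} (hθ : Monotone θ) (t : stdSimplex ℝ (Fin (m + 1))) :
    chainPoint (h.comp hθ) t = chainPoint h (stdSimplex.map θ t) :=
  realizationPoint_map (nerve A) (SimplexCategory.mkHom ⟨θ, hθ⟩) h.functor t

theorem chainPoint_congr {n : ℕ} {a a' : Fin (n + 1) → A} (h : IsObjChain a) (h' : IsObjChain a')
    (e : a = a') (t : stdSimplex ℝ (Fin (n + 1))) : chainPoint h t = chainPoint h' t := by
  subst e
  rfl

theorem nerveSpaceMap_chainPoint {B : Type u} [Category.{u} B] [Quiver.IsThin B] (F : A ⥤ B)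
    {n : ℕ} {a : Fin (n + 1) → A} (h : IsObjChain a) (t : stdSimplex ℝ (Fin (n + 1))) :
    nerveSpaceMap F (chainPoint h t) = chainPoint (h.map F) t := by
  refine (toTop_map_realizationPoint (nerveMap F) (n := SimplexCategory.mk n) h.functor t).trans ?_
  have : (nerveMap F).app (Opposite.op (SimplexCategory.mk n)) h.functor = (h.map F).functor :=
    CategoryTheory.Functor.ext (fun _ => rfl) (fun _ _ _ => Subsingleton.elim _ _)
  rw [this]
  rfl

/-- In a thin category a simplex of the nerve is determined by its objects, so it suffices to test
on chains of objects. -/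
theorem nerveSpace_hom_ext {T : Type u} [TopologicalSpace T] {f g : C(NerveSpace A, T)}
    (H : ∀ (n : ℕ) (a : Fin (n + 1) → A) (h : IsObjChain a) (t : stdSimplex ℝ (Fin (n + 1))),
      f (chainPoint h t) = g (chainPoint h t)) : f = g := by
  have : TopCat.ofHom (X := SSet.toTop.obj (nerve A)) (Y := TopCat.of T) f = TopCat.ofHom g := by
    apply realization_hom_ext
    intro n x t
    have hx : IsObjChain x.obj := fun i j hij => ⟨x.map (homOfLE hij)⟩
    have hx' : hx.functor = x :=
      CategoryTheory.Functor.ext (fun _ => rfl) (fun _ _ _ => Subsingleton.elim _ _)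
    have := H n.len x.obj hx t
    unfold chainPoint at this
    rw [hx'] at this
    exact this
  exact congrArg TopCat.Hom.hom this

theorem exists_nerveSpace_desc {T : Type u} [TopologicalSpace T]
    (F : ∀ (n : ℕ) (a : Fin (n + 1) → A), IsObjChain a → C(stdSimplex ℝ (Fin (n + 1)), T))
    (hF : ∀ (m n : ℕ) (a : Fin (n + 1) → A) (h : IsObjChain a) (θ : Fin (m + 1) → Fin (n + 1))
      (hθ : Monotone θ) (t : stdSimplex ℝ (Fin (m + 1))),
      F m (a ∘ θ) (h.comp hθ) t = F n a h (stdSimplex.map θ t)) :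
    ∃ g : C(NerveSpace A, T), ∀ (n : ℕ) (a : Fin (n + 1) → A) (h : IsObjChain a)
      (t : stdSimplex ℝ (Fin (n + 1))), g (chainPoint h t) = F n a h t := by
  obtain ⟨g, hg⟩ := exists_realization_desc (X := nerve A) (T := TopCat.of T)
    (fun n x => F n.len x.obj (fun i j hij => ⟨x.map (homOfLE hij)⟩))
    (fun m n θ x t => hF m.len n.len x.obj _ θ θ.toOrderHom.monotone t)
  exact ⟨g.hom, fun n a h t => hg (SimplexCategory.mk n) h.functor t⟩

end RealizationPoints

/-! ### Points given by weights on a finite labelled set -/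

section WeightedChains

theorem stdSimplex.map_apply {X Y : Type*} [Fintype X] [Fintype Y] [DecidableEq Y] (f : X → Y)
    (s : stdSimplex ℝ X) (y : Y) : stdSimplex.map f s y = ∑ x with f x = y, s x := by
  rw [stdSimplex.map_coe]
  exact FunOnFinite.linearMap_apply_apply ℝ ℝ f s y

theorem stdSimplex.map_apply_pos {X Y : Type*} [Fintype X] [Fintype Y] (f : X → Y)
    {s : stdSimplex ℝ X} {x : X} (h : 0 < s x) : 0 < stdSimplex.map f s (f x) := by
  classical
  rw [map_apply]
  exact lt_of_lt_of_le h
    (Finset.single_le_sum (f := s) (fun i _ => stdSimplex.zero_le s i) (by simp))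

theorem stdSimplex.exists_of_map_apply_pos {X Y : Type*} [Fintype X] [Fintype Y] (f : X → Y)
    {s : stdSimplex ℝ X} {y : Y} (h : 0 < stdSimplex.map f s y) : ∃ x, 0 < s x ∧ f x = y := by
  classical
  rw [map_apply] at h
  obtain ⟨x, hx, hx'⟩ := Finset.exists_lt_of_sum_lt (f := fun _ => (0 : ℝ)) (by simpa using h)
  exact ⟨x, hx', by simpa using hx⟩

theorem stdSimplex.map_apply_of_injective {X Y : Type*} [Fintype X] [Fintype Y] {f : X → Y}
    (hf : Function.Injective f) (s : stdSimplex ℝ X) (x : X) :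
    stdSimplex.map f s (f x) = s x := by
  classical
  rw [map_apply, Finset.sum_eq_single x] <;> simp +contextual [hf.eq_iff]

theorem stdSimplex.map_injective {X Y : Type*} [Fintype X] [Fintype Y] {f : X → Y}
    (hf : Function.Injective f) : Function.Injective (stdSimplex.map (S := ℝ) f) := by
  intro s t h
  ext x
  rw [← map_apply_of_injective hf s, h, map_apply_of_injective hf]

/-- Restriction of weights along an injection whose range contains the support. -/
def stdSimplex.restrict {X Y : Type*} [Fintype X] [Fintype Y] {f : X → Y}
    (hf : Function.Injective f) (w : stdSimplex ℝ Y) (hw : ∀ y, 0 < w y → y ∈ Set.range f) :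
    stdSimplex ℝ X :=
  ⟨fun x => w (f x), fun x => stdSimplex.zero_le w (f x), by
    rw [← stdSimplex.sum_eq_one w]
    refine Fintype.sum_of_injective f hf _ _ (fun y hy => ?_) (fun _ => rfl)
    exact ((stdSimplex.zero_le w y).eq_of_not_lt fun h => hy (hw y h)).symm⟩

theorem stdSimplex.restrict_apply {X Y : Type*} [Fintype X] [Fintype Y] {f : X → Y}
    (hf : Function.Injective f) (w : stdSimplex ℝ Y) (hw : ∀ y, 0 < w y → y ∈ Set.range f) (x : X) :
    restrict hf w hw x = w (f x) := rfl

theorem stdSimplex.map_restrict {X Y : Type*} [Fintype X] [Fintype Y] {f : X → Y}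
    (hf : Function.Injective f) (w : stdSimplex ℝ Y) (hw : ∀ y, 0 < w y → y ∈ Set.range f) :
    map f (restrict hf w hw) = w := by
  ext y
  by_cases hy : y ∈ Set.range f
  · obtain ⟨x, rfl⟩ := hy
    rw [map_apply_of_injective hf, restrict_apply]
  · rw [← (stdSimplex.zero_le w y).eq_of_not_lt fun h => hy (hw y h)]
    refine ((stdSimplex.zero_le _ y).eq_of_not_lt fun h => ?_).symm
    obtain ⟨x, -, rfl⟩ := exists_of_map_apply_pos f h
    exact hy ⟨x, rfl⟩

theorem stdSimplex.exists_pos {X : Type*} [Fintype X] (s : stdSimplex ℝ X) : ∃ x, 0 < s x := by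
  obtain ⟨x, -, hx⟩ := Finset.exists_lt_of_sum_lt (s := Finset.univ) (f := fun _ => (0 : ℝ)) (g := s)
    (by rw [stdSimplex.sum_eq_one]; simp)
  exact ⟨x, hx⟩

/-- Passing to the face spanned by the support discards the zero weights. -/
theorem stdSimplex.exists_map_strictMono {n : ℕ} (s : stdSimplex ℝ (Fin (n + 1))) :
    ∃ (k : ℕ) (ι : Fin (k + 1) → Fin (n + 1)) (s' : stdSimplex ℝ (Fin (k + 1))),
      StrictMono ι ∧ (∀ i, 0 < s' i) ∧ map ι s' = s := by
  classical
  obtain ⟨i0, hi0⟩ := exists_pos s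
  let F : Finset (Fin (n + 1)) := Finset.univ.filter fun i => 0 < s i
  have hF : F.card = (F.card - 1) + 1 := by
    have : 0 < F.card := Finset.card_pos.mpr ⟨i0, by simp [F, hi0]⟩
    omega
  let ι := F.orderEmbOfFin hF
  have hw : ∀ y, 0 < s y → y ∈ Set.range ι := fun y hy => by
    rw [Finset.range_orderEmbOfFin]
    simp [F, hy]
  refine ⟨F.card - 1, ι, restrict ι.injective s hw, ι.strictMono, fun i => ?_, map_restrict _ _ _⟩
  exact (Finset.mem_filter.mp (Finset.orderEmbOfFin_mem F hF i)).2

variable {E : Type u} [Category.{u} E] [Quiver.IsThin E]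

/-- Weights `w` on a finite set `D`, whose support is sorted by `r` and labelled by a chain of
objects, are the barycentric coordinates of the point `x` of `|E|`. -/
def IsWeightedPoint {D : Type*} [Fintype D] (r : D → D → Prop) (f : D → E) (w : stdSimplex ℝ D)
    (x : NerveSpace E) : Prop :=
  ∃ (m : ℕ) (a : Fin (m + 1) → D) (s : stdSimplex ℝ (Fin (m + 1))) (h : IsObjChain (f ∘ a)),
    (∀ i j, i < j → r (a i) (a j)) ∧ stdSimplex.map a s = w ∧ chainPoint h s = x

theorem injective_of_sorted {D : Type*} {r : D → D → Prop} (hr : ∀ d d', r d d' → ¬ r d' d)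
    {m : ℕ} {a : Fin (m + 1) → D} (ha : ∀ i j, i < j → r (a i) (a j)) : Function.Injective a := by
  intro i j hij
  by_contra hne
  rcases lt_or_gt_of_ne hne with h | h
  · have := ha _ _ h
    rw [hij] at this
    exact hr _ _ this this
  · have := ha _ _ h
    rw [hij] at this
    exact hr _ _ this this

theorem IsWeightedPoint.exists_pos {D : Type*} [Fintype D] {r : D → D → Prop} {f : D → E}
    {w : stdSimplex ℝ D} {x : NerveSpace E} (hw : IsWeightedPoint r f w x) :
    ∃ (m : ℕ) (a : Fin (m + 1) → D) (s : stdSimplex ℝ (Fin (m + 1))) (h : IsObjChain (f ∘ a)),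
      (∀ i, 0 < s i) ∧ (∀ i j, i < j → r (a i) (a j)) ∧ stdSimplex.map a s = w ∧
        chainPoint h s = x := by
  obtain ⟨m, a, s, h, ha, rfl, rfl⟩ := hw
  obtain ⟨k, ι, s', hι, hs', rfl⟩ := stdSimplex.exists_map_strictMono s
  refine ⟨k, a ∘ ι, s', h.comp hι.monotone, hs', fun i j hij => ha _ _ (hι hij), ?_, ?_⟩
  · rw [stdSimplex.map_comp_apply]
  · exact chainPoint_comp h hι.monotone s'

/-- The workhorse for equality of points. On the support of `w`, the map `φ` is weakly monotone for
the two sorted orders, so it is induced by a simplicial operator `θ`; weights and labels correspond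
under `θ`, and the realization identifies the two points. Only vertices of positive weight matter,
so nothing is required off the support. -/
theorem IsWeightedPoint.eq_of_map {D D' : Type*} [Fintype D] [Fintype D'] {r : D → D → Prop}
    {r' : D' → D' → Prop} (hr' : ∀ d d', r' d d' → ¬ r' d' d) {f : D → E} {f' : D' → E}
    (φ : D → D') {w : stdSimplex ℝ D} {x x' : NerveSpace E} (hw : IsWeightedPoint r f w x)
    (hw' : IsWeightedPoint r' f' (stdSimplex.map φ w) x')
    (hφ : ∀ d d', 0 < w d → 0 < w d' → r d d' → φ d = φ d' ∨ r' (φ d) (φ d'))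
    (hf : ∀ d, 0 < w d → f' (φ d) = f d) : x = x' := by
  obtain ⟨m, a, s, h, hs, ha, rfl, rfl⟩ := hw.exists_pos
  obtain ⟨m', a', s', h', ha', e, rfl⟩ := hw'
  have hpos : ∀ i, 0 < stdSimplex.map a s (a i) := fun i => stdSimplex.map_apply_pos a (hs i)
  have hinj := injective_of_sorted hr' ha'
  have hex : ∀ i, ∃ j, a' j = φ (a i) := fun i => by
    have h1 := stdSimplex.map_apply_pos φ (hpos i)
    rw [← e] at h1
    obtain ⟨j, -, hj⟩ := stdSimplex.exists_of_map_apply_pos a' h1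
    exact ⟨j, hj⟩
  choose θ hθ using hex
  have hmono : Monotone θ := by
    intro i j hij
    rcases hij.eq_or_lt with rfl | hij
    · exact le_rfl
    · by_contra hlt
      push Not at hlt
      have h2 := ha' _ _ hlt
      rw [hθ, hθ] at h2
      rcases hφ _ _ (hpos i) (hpos j) (ha _ _ hij) with h1 | h1
      · rw [h1] at h2
        exact hr' _ _ h2 h2
      · exact hr' _ _ h1 h2
  have hs' : s' = stdSimplex.map θ s := by
    apply stdSimplex.map_injective hinj
    rw [e, stdSimplex.map_comp_apply, stdSimplex.map_comp_apply]
    congr 1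
    funext i
    exact (hθ i).symm
  rw [hs', ← chainPoint_comp h' hmono]
  refine chainPoint_congr _ _ ?_ s
  funext i
  simp only [Function.comp_apply]
  rw [hθ, hf _ (hpos i)]

theorem IsWeightedPoint.unique {D : Type*} [Fintype D] {r : D → D → Prop}
    (hr : ∀ d d', r d d' → ¬ r d' d) {f : D → E} {w : stdSimplex ℝ D} {x x' : NerveSpace E}
    (hw : IsWeightedPoint r f w x) (hw' : IsWeightedPoint r f w x') : x = x' :=
  hw.eq_of_map hr id (by rwa [stdSimplex.map_id_apply]) (fun _ _ _ _ h => Or.inr h)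
    (fun _ _ => rfl)

theorem IsWeightedPoint.map {D : Type*} [Fintype D] {r : D → D → Prop} {f : D → E}
    {w : stdSimplex ℝ D} {x : NerveSpace E} (hw : IsWeightedPoint r f w x) {E' : Type u}
    [Category.{u} E'] [Quiver.IsThin E'] (F : E ⥤ E') :
    IsWeightedPoint r (F.obj ∘ f) w (nerveSpaceMap F x) := by
  obtain ⟨m, a, s, h, ha, rfl, rfl⟩ := hw
  exact ⟨m, a, s, h.map F, ha, rfl, (nerveSpaceMap_chainPoint F h s).symm⟩

theorem exists_isWeightedPoint {D : Type*} [Fintype D] {r : D → D → Prop}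
    (hr : ∀ d d', r d d' → ¬ r d' d) {f : D → E} {w : stdSimplex ℝ D}
    (htot : ∀ d d', 0 < w d → 0 < w d' → d ≠ d' → r d d' ∨ r d' d)
    (htrans : ∀ d d' d'', 0 < w d → 0 < w d' → 0 < w d'' → r d d' → r d' d'' → r d d'')
    (hf : ∀ d d', 0 < w d → 0 < w d' → r d d' → Nonempty (f d ⟶ f d')) :
    ∃ x, IsWeightedPoint r f w x := by
  classical
  -- The relation `r` need only be a strict total order on the support; sorting the support gives
  -- the chain.
  let T := {d : D // 0 < w d}
  let rT : T → T → Prop := fun d d' => r d.1 d'.1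
  have : IsStrictTotalOrder T rT :=
    { trichotomous := fun d d' h1 h2 => by
        by_contra hne
        rcases htot d.1 d'.1 d.2 d'.2 (fun h => hne (Subtype.ext h)) with h | h
        · exact h1 h
        · exact h2 h
      irrefl := fun d h => hr _ _ h h
      trans := fun d d' d'' h h' => htrans _ _ _ d.2 d'.2 d''.2 h h' }
  let _ : LinearOrder T := linearOrderOfSTO rT
  obtain ⟨d0, hd0⟩ := stdSimplex.exists_pos w
  have hcard : Fintype.card T = (Fintype.card T - 1) + 1 := by
    have : 0 < Fintype.card T := Fintype.card_pos_iff.mpr ⟨⟨d0, hd0⟩⟩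
    omega
  let e := Fintype.orderIsoFinOfCardEq T hcard
  have ha : ∀ i j, i < j → r (e i).1 (e j).1 := fun i j hij => e.strictMono hij
  have hch : IsObjChain (f ∘ fun i => (e i).1) := by
    intro i j hij
    rcases hij.eq_or_lt with rfl | hij
    · exact ⟨𝟙 _⟩
    · exact hf _ _ (e i).2 (e j).2 (ha i j hij)
  have hsupp : ∀ d, 0 < w d → d ∈ Set.range fun i => (e i).1 := fun d hd =>
    ⟨e.symm ⟨d, hd⟩, by simp⟩
  exact ⟨_, _, _, stdSimplex.restrict (injective_of_sorted hr ha) w hsupp, hch, ha,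
    stdSimplex.map_restrict _ _ _, rfl⟩

/-- Uniqueness makes the pointwise choice canonical. It is continuous on each closed set where the
weights are supported in a fixed sorted chain, and finitely many such sets cover `X`. -/
theorem exists_continuous_isWeightedPoint {D : Type*} [Fintype D] {r : D → D → Prop}
    (hr : ∀ d d', r d d' → ¬ r d' d) {f : D → E} {X : Type*} [TopologicalSpace X]
    (W : C(X, stdSimplex ℝ D)) (hW : ∀ x, ∃ y, IsWeightedPoint r f (W x) y) :
    ∃ g : C(X, NerveSpace E), ∀ x, IsWeightedPoint r f (W x) (g x) := by
  classical
  choose g hg using hW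
  let Z : {F : Finset D // ∃ (m : ℕ) (a : Fin (m + 1) → D), IsObjChain (f ∘ a) ∧
      (∀ i j, i < j → r (a i) (a j)) ∧ Set.range a = F} → Set X :=
    fun F => {x | ∀ d, d ∉ F.1 → W x d = 0}
  have hWc : ∀ d, Continuous fun x => W x d := fun d =>
    (continuous_apply d).comp (continuous_subtype_val.comp W.continuous)
  refine ⟨⟨g, (locallyFinite_of_finite Z).continuous ?_ ?_ ?_⟩, hg⟩
  · refine Set.eq_univ_of_forall fun x => ?_
    obtain ⟨m, a, s, h, ha, e, -⟩ := hg x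
    refine Set.mem_iUnion.mpr ⟨⟨Finset.univ.image a, m, a, h, ha, by simp⟩, fun d hd => ?_⟩
    refine ((stdSimplex.zero_le (W x) d).eq_of_not_lt fun h => hd ?_).symm
    rw [← e] at h
    obtain ⟨i, -, rfl⟩ := stdSimplex.exists_of_map_apply_pos a h
    simp
  · intro F
    simp only [Z, Set.ofPred_forall]
    exact isClosed_iInter fun d => isClosed_iInter fun _ =>
      isClosed_eq (hWc d) continuous_const
  · rintro ⟨F, m, a, h, ha, hF⟩
    rw [continuousOn_iff_continuous_domRestrict]
    have hsupp : ∀ (x : Z ⟨F, m, a, h, ha, hF⟩) (d : D), 0 < W x.1 d → d ∈ Set.range a := by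
      intro x d hd
      rw [hF]
      by_contra hdF
      exact hd.ne' (x.2 d hdF)
    have hinj := injective_of_sorted hr ha
    have : Set.domRestrict (Z ⟨F, m, a, h, ha, hF⟩) g =
        fun x => chainPoint h (stdSimplex.restrict hinj (W x.1) (hsupp x)) := by
      funext x
      exact (hg x.1).unique hr
        ⟨m, a, _, h, ha, stdSimplex.map_restrict hinj (W x.1) (hsupp x), rfl⟩
    rw [this]
    refine (chainPoint h).continuous.comp (Continuous.subtype_mk ?_ _)
    exact continuous_pi fun i => (hWc (a i)).comp continuous_subtype_val

end WeightedChains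

/-! ### Chains of a poset and the weights of the subdivision -/

section ChainSets

/-- The nonempty finite chains of a partially ordered set. -/
def ChainSet (B : Type*) [PartialOrder B] : Type _ :=
  {τ : Finset B // τ.Nonempty ∧ IsChain (· ≤ ·) (τ : Set B)}

namespace ChainSet

variable {B : Type*} [PartialOrder B]

noncomputable instance [Fintype B] : Fintype (ChainSet B) := by
  classical
  exact inferInstanceAs (Fintype {τ : Finset B // τ.Nonempty ∧ IsChain (· ≤ ·) (τ : Set B)})

theorem ext {τ τ' : ChainSet B} (h : τ.1 = τ'.1) : τ = τ' := Subtype.ext h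

theorem exists_bot (τ : ChainSet B) : ∃ b ∈ τ.1, ∀ b' ∈ τ.1, b ≤ b' := by
  obtain ⟨b, hb, hmin⟩ := τ.1.exists_minimal τ.2.1
  refine ⟨b, hb, fun b' hb' => ?_⟩
  rcases τ.2.2.total hb hb' with h | h
  · exact h
  · exact hmin hb' h

/-- The least element of a chain. -/
noncomputable def bot (τ : ChainSet B) : B := τ.exists_bot.choose

theorem bot_mem (τ : ChainSet B) : τ.bot ∈ τ.1 := τ.exists_bot.choose_spec.1

theorem bot_le (τ : ChainSet B) {b : B} (hb : b ∈ τ.1) : τ.bot ≤ b :=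
  τ.exists_bot.choose_spec.2 b hb

theorem bot_le_bot {τ τ' : ChainSet B} (h : τ'.1 ⊆ τ.1) : τ.bot ≤ τ'.bot :=
  τ.bot_le (h τ'.bot_mem)

theorem bot_eq {τ : ChainSet B} {b : B} (hb : b ∈ τ.1) (h : ∀ b' ∈ τ.1, b ≤ b') : τ.bot = b :=
  le_antisymm (τ.bot_le hb) (h _ τ.bot_mem)

/-- The action of an automorphism of a partially ordered set on its chains. -/
def map (γ : B ≃o B) (τ : ChainSet B) : ChainSet B :=
  ⟨τ.1.map γ.toEquiv.toEmbedding, by simpa using τ.2.1, by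
    rintro x hx y hy -
    simp only [Finset.coe_map, Set.mem_image] at hx hy
    obtain ⟨x, hx, rfl⟩ := hx
    obtain ⟨y, hy, rfl⟩ := hy
    rcases τ.2.2.total hx hy with h | h
    · exact Or.inl (γ.monotone h)
    · exact Or.inr (γ.monotone h)⟩

theorem mem_map {γ : B ≃o B} {τ : ChainSet B} {b : B} : γ b ∈ (τ.map γ).1 ↔ b ∈ τ.1 := by
  simp [map]

theorem exists_of_mem_map {γ : B ≃o B} {τ : ChainSet B} {b : B} (hb : b ∈ (τ.map γ).1) :
    ∃ b' ∈ τ.1, γ b' = b := by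
  obtain ⟨b, rfl⟩ := γ.surjective b
  exact ⟨b, mem_map.mp hb, rfl⟩

theorem map_injective (γ : B ≃o B) : Function.Injective (map γ) := by
  intro τ τ' h
  exact ext (Finset.map_injective _ (congrArg Subtype.val h))

theorem map_surjective (γ : B ≃o B) : Function.Surjective (map γ) := by
  intro τ
  refine ⟨τ.map γ.symm, ext ?_⟩
  ext b
  obtain ⟨b, rfl⟩ := γ.surjective b
  rw [mem_map]
  conv_lhs => rw [← γ.symm_apply_apply b]
  rw [mem_map]

theorem bot_map (γ : B ≃o B) (τ : ChainSet B) : (τ.map γ).bot = γ τ.bot := by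
  refine bot_eq (mem_map.mpr τ.bot_mem) fun b hb => ?_
  obtain ⟨b', hb', rfl⟩ := exists_of_mem_map hb
  exact γ.monotone (τ.bot_le hb')

theorem card_map (γ : B ≃o B) (τ : ChainSet B) : (τ.map γ).1.card = τ.1.card :=
  Finset.card_map _

theorem map_subset_map {γ : B ≃o B} {τ τ' : ChainSet B} :
    (τ.map γ).1 ⊆ (τ'.map γ).1 ↔ τ.1 ⊆ τ'.1 :=
  Finset.map_subset_map

theorem map_ssubset_map {γ : B ≃o B} {τ τ' : ChainSet B} :
    (τ.map γ).1 ⊂ (τ'.map γ).1 ↔ τ.1 ⊂ τ'.1 :=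
  Finset.map_ssubset_map

variable [Fintype B]

open Classical in
/-- Up to normalization and a factor `u τ.bot`, the coordinate of the vertex `τ` in the
barycentric subdivision at the point with weights `u`. It is nonzero only if `τ` is a superlevel
set of `u`. -/
noncomputable def coef (u : B → ℝ) (τ : ChainSet B) : ℝ :=
  (∏ b ∈ τ.1, u b) * ∏ b ∈ τ.1, ∏ b' ∈ τ.1ᶜ, max (u b - u b') 0

theorem continuous_coef (τ : ChainSet B) : Continuous fun u : B → ℝ => coef u τ := by
  unfold coef
  fun_prop

theorem coef_nonneg {u : B → ℝ} (hu : ∀ b, 0 ≤ u b) (τ : ChainSet B) : 0 ≤ coef u τ :=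
  mul_nonneg (Finset.prod_nonneg fun _ _ => hu _)
    (Finset.prod_nonneg fun _ _ => Finset.prod_nonneg fun _ _ => le_max_right _ _)

theorem coef_ne_zero_iff {u : B → ℝ} (hu : ∀ b, 0 ≤ u b) {τ : ChainSet B} :
    coef u τ ≠ 0 ↔ (∀ b ∈ τ.1, 0 < u b) ∧ ∀ b ∈ τ.1, ∀ b', b' ∉ τ.1 → u b' < u b := by
  classical
  have h1 : ∀ b, u b ≠ 0 ↔ 0 < u b := fun b => ⟨fun h => (hu b).lt_of_ne' h, fun h => h.ne'⟩
  have h2 : ∀ b b', max (u b - u b') 0 ≠ 0 ↔ u b' < u b := fun b b' => by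
    rw [ne_eq, max_eq_right_iff, not_le, sub_pos]
  simp only [coef, mul_ne_zero_iff, Finset.prod_ne_zero_iff, Finset.mem_compl, h1, h2]

theorem coef_pos_iff {u : B → ℝ} (hu : ∀ b, 0 ≤ u b) {τ : ChainSet B} :
    0 < coef u τ ↔ (∀ b ∈ τ.1, 0 < u b) ∧ ∀ b ∈ τ.1, ∀ b', b' ∉ τ.1 → u b' < u b := by
  rw [← coef_ne_zero_iff hu]
  exact ⟨fun h => h.ne', fun h => (coef_nonneg hu τ).lt_of_ne' h⟩

/-- Superlevel sets of one function are nested. -/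
theorem subset_or_subset {u : B → ℝ} (hu : ∀ b, 0 ≤ u b) {τ τ' : ChainSet B} (h : 0 < coef u τ)
    (h' : 0 < coef u τ') : τ.1 ⊆ τ'.1 ∨ τ'.1 ⊆ τ.1 := by
  by_contra hcon
  push Not at hcon
  obtain ⟨h1, h2⟩ := hcon
  obtain ⟨b, hb, hb'⟩ := Finset.not_subset.mp h1
  obtain ⟨d, hd, hd'⟩ := Finset.not_subset.mp h2
  exact lt_asymm (((coef_pos_iff hu).mp h).2 b hb d hd') (((coef_pos_iff hu).mp h').2 d hd b hb')

theorem coef_map (γ : B ≃o B) (u : B → ℝ) (τ : ChainSet B) :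
    coef u (τ.map γ) = coef (u ∘ γ) τ := by
  classical
  have : (τ.map γ).1ᶜ = τ.1ᶜ.map γ.toEquiv.toEmbedding := by
    ext b
    obtain ⟨b, rfl⟩ := γ.surjective b
    rw [Finset.mem_compl, mem_map]
    simp
  unfold coef
  rw [this]
  simp [map]

/-- The normalizing factor of the barycentric subdivision. -/
noncomputable def total (u : B → ℝ) : ℝ := ∑ τ : ChainSet B, u τ.bot * coef u τ

theorem continuous_total : Continuous fun u : B → ℝ => total u := by
  unfold total
  have := continuous_coef (B := B)
  fun_prop

theorem total_map (γ : B ≃o B) (u : B → ℝ) : total (u ∘ γ) = total u := by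
  unfold total
  refine Fintype.sum_bijective (map γ) ⟨map_injective γ, map_surjective γ⟩ _ _ fun τ => ?_
  rw [coef_map, bot_map]
  rfl

/-- The support of `u` is itself a chain and a superlevel set, so its own term is positive. -/
theorem total_pos {u : B → ℝ} (hu : ∀ b, 0 ≤ u b) (hne : ∃ b, 0 < u b)
    (hchain : IsChain (· ≤ ·) {b | 0 < u b}) : 0 < total u := by
  classical
  let τ : ChainSet B := ⟨Finset.univ.filter fun b => 0 < u b, by
    obtain ⟨b, hb⟩ := hne
    exact ⟨b, by simpa using hb⟩, by simpa using hchain⟩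
  have hτ : ∀ b, b ∈ τ.1 ↔ 0 < u b := fun b => by simp [τ]
  refine Finset.sum_pos' (fun τ _ => mul_nonneg (hu _) (coef_nonneg hu τ))
    ⟨τ, Finset.mem_univ _, mul_pos ((hτ _).mp τ.bot_mem) ((coef_pos_iff hu).mpr
      ⟨fun b hb => (hτ b).mp hb, fun b hb b' hb' => ?_⟩)⟩
  rw [hτ] at hb hb'
  exact lt_of_le_of_lt (not_lt.mp hb') hb

/-- The weights of the barycentric subdivision at a point whose support is a chain. -/
noncomputable def bary (u : stdSimplex ℝ B) (hu : IsChain (· ≤ ·) {b | 0 < u b}) :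
    stdSimplex ℝ (ChainSet B) :=
  ⟨fun τ => u τ.bot * coef u τ / total u, fun τ =>
    div_nonneg (mul_nonneg (stdSimplex.zero_le u _) (coef_nonneg (stdSimplex.zero_le u) τ))
      (total_pos (stdSimplex.zero_le u) (stdSimplex.exists_pos u) hu).le, by
    rw [← Finset.sum_div]
    exact div_self (total_pos (stdSimplex.zero_le u) (stdSimplex.exists_pos u) hu).ne'⟩

theorem bary_apply (u : stdSimplex ℝ B) (hu : IsChain (· ≤ ·) {b | 0 < u b}) (τ : ChainSet B) :
    bary u hu τ = u τ.bot * coef u τ / total u := rfl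

theorem coef_pos_of_bary_pos {u : stdSimplex ℝ B} {hu : IsChain (· ≤ ·) {b | 0 < u b}}
    {τ : ChainSet B} (h : 0 < bary u hu τ) : 0 < coef u τ := by
  refine (coef_nonneg (stdSimplex.zero_le u) τ).lt_of_ne' fun h0 => h.ne' ?_
  rw [bary_apply, h0, mul_zero, zero_div]

theorem map_comp_orderIso (γ : B ≃o B) (u : stdSimplex ℝ B) :
    (stdSimplex.map γ u : B → ℝ) ∘ γ = u := by
  funext b
  exact stdSimplex.map_apply_of_injective γ.injective u b

theorem map_bary (γ : B ≃o B) (u : stdSimplex ℝ B) (hu : IsChain (· ≤ ·) {b | 0 < u b})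
    (hu' : IsChain (· ≤ ·) {b | 0 < stdSimplex.map γ u b}) :
    stdSimplex.map (map γ) (bary u hu) = bary (stdSimplex.map γ u) hu' := by
  ext τ
  obtain ⟨τ, rfl⟩ := map_surjective γ τ
  rw [stdSimplex.map_apply_of_injective (map_injective γ), bary_apply, bary_apply, coef_map,
    ← total_map γ (stdSimplex.map γ u), map_comp_orderIso, bot_map,
    stdSimplex.map_apply_of_injective γ.injective]

end ChainSet

end ChainSets

/-! ### Treating an order and its dual together -/

section Orientation

/-- The relation `r`, reversed if `ε` is true. -/
def orient (ε : Bool) {D : Type*} (r : D → D → Prop) (d d' : D) : Prop :=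
  match ε with
  | false => r d d'
  | true => r d' d

theorem orient_asymm (ε : Bool) {D : Type*} {r : D → D → Prop} (hr : ∀ d d', r d d' → ¬ r d' d)
    (d d' : D) (h : orient ε r d d') : ¬ orient ε r d' d := by
  cases ε
  · exact hr d d' h
  · exact hr d' d h

theorem orient_mono (ε : Bool) {D D' : Type*} {r : D → D → Prop} {r' : D' → D' → Prop}
    {f : D → D'} (h : ∀ d d', r d d' → r' (f d) (f d')) {d d' : D} (hd : orient ε r d d') :
    orient ε r' (f d) (f d') := by
  cases ε
  · exact h _ _ hd
  · exact h _ _ hd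

theorem orient_orient (ε : Bool) {D : Type*} {r : D → D → Prop} {d d' : D} :
    orient ε (orient ε r) d d' ↔ r d d' := by
  cases ε <;> rfl

/-- There is a morphism between two objects. -/
def HasArrow {A : Type*} [Category* A] (a a' : A) : Prop := Nonempty (a ⟶ a')

variable {E : Type u} [Category.{u} E] [Quiver.IsThin E]

theorem exists_isWeightedPoint_orient (ε : Bool) {D : Type*} [Fintype D] {r : D → D → Prop}
    (hr : ∀ d d', r d d' → ¬ r d' d) {f : D → E} {w : stdSimplex ℝ D}
    (htot : ∀ d d', 0 < w d → 0 < w d' → d ≠ d' → r d d' ∨ r d' d)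
    (htrans : ∀ d d' d'', 0 < w d → 0 < w d' → 0 < w d'' → r d d' → r d' d'' → r d d'')
    (hf : ∀ d d', 0 < w d → 0 < w d' → r d d' → orient ε HasArrow (f d) (f d')) :
    ∃ x, IsWeightedPoint (orient ε r) f w x := by
  refine exists_isWeightedPoint (orient_asymm ε hr) ?_ ?_ ?_ <;> cases ε
  · exact htot
  · exact fun d d' h h' hne => (htot d d' h h' hne).symm
  · exact htrans
  · exact fun d d' d'' h h' h'' e e' => htrans d'' d' d h'' h' h e' e
  · exact hf
  · exact fun d d' h h' e => hf d' d h' h e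

theorem IsWeightedPoint.eq_of_map_orient {ε : Bool} {D D' : Type*} [Fintype D] [Fintype D']
    {r : D → D → Prop} {r' : D' → D' → Prop} (hr' : ∀ d d', r' d d' → ¬ r' d' d) {f : D → E}
    {f' : D' → E} (φ : D → D') {w : stdSimplex ℝ D} {x x' : NerveSpace E}
    (hw : IsWeightedPoint (orient ε r) f w x)
    (hw' : IsWeightedPoint (orient ε r') f' (stdSimplex.map φ w) x')
    (hφ : ∀ d d', 0 < w d → 0 < w d' → r d d' → φ d = φ d' ∨ r' (φ d) (φ d'))
    (hf : ∀ d, 0 < w d → f' (φ d) = f d) : x = x' := by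
  refine hw.eq_of_map (orient_asymm ε hr') φ hw' ?_ hf
  cases ε
  · exact hφ
  · exact fun d d' h h' e => (hφ d' d h' h e).imp_left Eq.symm

end Orientation

/-! ### The map through the barycentric subdivision -/

section SubdivisionMap

variable {B : Type*} [PartialOrder B] {A : Type u} [Category.{u} A]

theorem isChain_support [Fintype B] {n : ℕ} {b : Fin (n + 1) → B}
    (hb : ∀ j j', b j ≤ b j' ∨ b j' ≤ b j) (t : stdSimplex ℝ (Fin (n + 1))) :
    IsChain (· ≤ ·) {x | 0 < stdSimplex.map b t x} := by
  intro x hx y hy _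
  obtain ⟨j, -, rfl⟩ := stdSimplex.exists_of_map_apply_pos b hx
  obtain ⟨j', -, rfl⟩ := stdSimplex.exists_of_map_apply_pos b hy
  exact hb j j'

theorem IsObjChain.comparable {n : ℕ} {a : Fin (n + 1) → A} (h : IsObjChain a) {ε : Bool}
    {i : A → B} (hi : ∀ x y, HasArrow x y → orient ε (· ≤ ·) (i x) (i y)) (j j' : Fin (n + 1)) :
    (i ∘ a) j ≤ (i ∘ a) j' ∨ (i ∘ a) j' ≤ (i ∘ a) j := by
  rcases le_total j j' with hj | hj
  · have := hi _ _ (h j j' hj)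
    cases ε
    · exact Or.inl this
    · exact Or.inr this
  · have := hi _ _ (h j' j hj)
    cases ε
    · exact Or.inr this
    · exact Or.inl this

/-- Strict reverse inclusion of chains. -/
def revInclusion (τ τ' : ChainSet B) : Prop := τ'.1 ⊂ τ.1

theorem revInclusion_asymm (τ τ' : ChainSet B) (h : revInclusion τ τ') : ¬ revInclusion τ' τ :=
  fun h' => lt_asymm (a := τ.1) (b := τ'.1) h' h

theorem ChainSet.eq_or_revInclusion {τ τ' : ChainSet B} (h : τ'.1 ⊆ τ.1) :
    τ = τ' ∨ revInclusion τ τ' :=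
  h.eq_or_ssubset.imp (fun h => ChainSet.ext h.symm) id

variable [Fintype B] [Quiver.IsThin A] {E : Type u} [Category.{u} E] [Quiver.IsThin E]

theorem exists_bary_isWeightedPoint (ε : Bool) {c : ChainSet B → E}
    (hc : ∀ τ τ' : ChainSet B, τ'.1 ⊆ τ.1 → orient ε HasArrow (c τ) (c τ'))
    (u : stdSimplex ℝ B) (hu : IsChain (· ≤ ·) {b | 0 < u b}) :
    ∃ x, IsWeightedPoint (orient ε revInclusion) c (ChainSet.bary u hu) x := by
  refine exists_isWeightedPoint_orient ε revInclusion_asymm (fun τ τ' h h' hne => ?_)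
    (fun _ _ _ _ _ _ h h' => LT.lt.trans h' h) (fun τ τ' _ _ h => hc _ _ h.subset)
  rcases ChainSet.subset_or_subset (stdSimplex.zero_le u) (ChainSet.coef_pos_of_bary_pos h)
    (ChainSet.coef_pos_of_bary_pos h') with hs | hs
  · exact Or.inr ((ChainSet.eq_or_revInclusion hs).resolve_left hne.symm)
  · exact Or.inl ((ChainSet.eq_or_revInclusion hs).resolve_left hne)

/-- The property that `g : |A| → |E|` is the composite of the map `|A| → |sd B|` given by
`i : A → B` and barycentric subdivision with the map `|sd B| → |E|` given by `c`. -/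
def IsSubdivisionMap (ε : Bool) (i : A → B) (c : ChainSet B → E)
    (g : C(NerveSpace A, NerveSpace E)) : Prop :=
  ∀ (n : ℕ) (a : Fin (n + 1) → A) (h : IsObjChain a) (t : stdSimplex ℝ (Fin (n + 1)))
    (hu : IsChain (· ≤ ·) {x | 0 < stdSimplex.map (i ∘ a) t x}),
    IsWeightedPoint (orient ε revInclusion) c (ChainSet.bary (stdSimplex.map (i ∘ a) t) hu)
      (g (chainPoint h t))

/-- The chains carrying weight are nested, so `c` sends them to a chain of objects. The weights
depend only on the pushforward of `t` to `B`, which does not change under simplicial operators;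
hence the maps on simplices glue. -/
theorem exists_isSubdivisionMap {ε : Bool} {i : A → B}
    (hi : ∀ x y, HasArrow x y → orient ε (· ≤ ·) (i x) (i y)) {c : ChainSet B → E}
    (hc : ∀ τ τ' : ChainSet B, τ'.1 ⊆ τ.1 → orient ε HasArrow (c τ) (c τ')) :
    ∃ g : C(NerveSpace A, NerveSpace E), IsSubdivisionMap ε i c g := by
  have key : ∀ (n : ℕ) (a : Fin (n + 1) → A) (h : IsObjChain a),
      ∃ g : C(stdSimplex ℝ (Fin (n + 1)), NerveSpace E), ∀ t,
        IsWeightedPoint (orient ε revInclusion) c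
          (ChainSet.bary (stdSimplex.map (i ∘ a) t) (isChain_support (h.comparable hi) t)) (g t) := by
    intro n a h
    refine exists_continuous_isWeightedPoint (orient_asymm ε revInclusion_asymm)
      ⟨fun t => ChainSet.bary (stdSimplex.map (i ∘ a) t) (isChain_support (h.comparable hi) t), ?_⟩
      (fun t => exists_bary_isWeightedPoint ε hc _
        (isChain_support (h.comparable hi) t))
    refine Continuous.subtype_mk (continuous_pi fun τ => ?_) _
    have hm : Continuous fun t : stdSimplex ℝ (Fin (n + 1)) =>
        (stdSimplex.map (i ∘ a) t : B → ℝ) :=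
      continuous_subtype_val.comp (stdSimplex.continuous_map (i ∘ a))
    refine Continuous.div (((continuous_apply _).comp hm).mul
      ((ChainSet.continuous_coef τ).comp hm)) (ChainSet.continuous_total.comp hm) fun t => ?_
    exact (ChainSet.total_pos (stdSimplex.zero_le _) (stdSimplex.exists_pos _)
      (isChain_support (h.comparable hi) t)).ne'
  choose F hF using key
  obtain ⟨g, hg⟩ := exists_nerveSpace_desc F (fun m n a h θ hθ t => by
    refine (hF m _ (h.comp hθ) t).unique (orient_asymm ε revInclusion_asymm) ?_
    have := hF n a h (stdSimplex.map θ t)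
    simp only [stdSimplex.map_comp_apply] at this
    exact this)
  refine ⟨g, fun n a h t hu => ?_⟩
  rw [hg]
  exact hF n a h t

theorem IsSubdivisionMap.comp {ε : Bool} {i : A → B} {c : ChainSet B → E}
    {g : C(NerveSpace A, NerveSpace E)} (hg : IsSubdivisionMap ε i c g) {A' : Type u}
    [Category.{u} A'] [Quiver.IsThin A'] (F : A' ⥤ A) :
    IsSubdivisionMap ε (i ∘ F.obj) c (g.comp (nerveSpaceMap F)) := by
  intro n a h t hu
  rw [ContinuousMap.comp_apply, nerveSpaceMap_chainPoint]
  exact hg n _ (h.map F) t hu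

theorem IsSubdivisionMap.map {ε : Bool} {i : A → B} {c : ChainSet B → E}
    {g : C(NerveSpace A, NerveSpace E)} (hg : IsSubdivisionMap ε i c g) {E' : Type u}
    [Category.{u} E'] [Quiver.IsThin E'] (F : E ⥤ E') :
    IsSubdivisionMap ε i (F.obj ∘ c) ((nerveSpaceMap F).comp g) :=
  fun n a h t hu => (hg n a h t hu).map F

/-- Equivariance of `g`: the subdivision weights commute with the automorphism `γ`, and so do the
labels by assumption. -/
theorem IsSubdivisionMap.comp_eq_comp {ε : Bool} {i : A → B}
    (hi : ∀ x y, HasArrow x y → orient ε (· ≤ ·) (i x) (i y)) {c : ChainSet B → E}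
    {g : C(NerveSpace A, NerveSpace E)} (hg : IsSubdivisionMap ε i c g) (γ : B ≃o B) {F : A ⥤ A}
    {F' : E ⥤ E} (hF : ∀ x, i (F.obj x) = γ (i x)) (hF' : ∀ τ, c (τ.map γ) = F'.obj (c τ)) :
    g.comp (nerveSpaceMap F) = (nerveSpaceMap F').comp g := by
  refine nerveSpace_hom_ext fun n a h t => Eq.symm ?_
  have hu := isChain_support (h.comparable hi) t
  have hu' := isChain_support ((h.map F).comparable hi) t
  have e : i ∘ F.obj ∘ a = γ ∘ i ∘ a := funext fun j => hF (a j)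
  refine (hg.map F' n a h t hu).eq_of_map_orient (f' := c) revInclusion_asymm (ChainSet.map γ)
    ?_ (fun τ τ' _ _ h => Or.inr (ChainSet.map_ssubset_map.mpr h)) (fun τ _ => hF' τ)
  have h1 := hg n _ (h.map F) t hu'
  rw [← nerveSpaceMap_chainPoint] at h1
  simp only [e, ← stdSimplex.map_comp_apply] at h1
  rw [ChainSet.map_bary]
  exact h1

end SubdivisionMap

/-! ### Order and weights of the homotopy -/

section SubdivisionHomotopy

variable {B : Type*} [PartialOrder B]

/-- The vertices of the homotopy on a simplex of dimension `n`: the vertices of the simplex,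
those of the subdivision, and pairs of such. -/
abbrev HomotopyIndex (B : Type*) [PartialOrder B] (n : ℕ) : Type _ :=
  Fin (n + 1) ⊕ (ChainSet B × Fin (n + 1)) ⊕ ChainSet B

/-- The order in which the vertices of the homotopy occur in a chain. -/
def homotopyOrder (ε : Bool) {n : ℕ} (b : Fin (n + 1) → B) :
    HomotopyIndex B n → HomotopyIndex B n → Prop
  | Sum.inl j, Sum.inl j' => orient ε (· < ·) j j'
  | Sum.inl j, Sum.inr (Sum.inl (τ, _)) => b j ≤ τ.bot
  | Sum.inr (Sum.inl (τ, _)), Sum.inl j => τ.bot < b j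
  | Sum.inr (Sum.inl (τ, j)), Sum.inr (Sum.inl (τ', j')) =>
      revInclusion τ τ' ∨ (τ = τ' ∧ orient ε (· < ·) j j')
  | Sum.inr (Sum.inl (τ, _)), Sum.inr (Sum.inr τ') => τ'.1 ⊆ τ.1
  | Sum.inr (Sum.inr τ), Sum.inr (Sum.inr τ') => revInclusion τ τ'
  | _, _ => False

theorem orient_lt_asymm (ε : Bool) {n : ℕ} (j j' : Fin n) :
    orient ε (· < ·) j j' → ¬ orient ε (· < ·) j' j :=
  orient_asymm ε (fun _ _ => lt_asymm) j j'

theorem homotopyOrder_asymm (ε : Bool) {n : ℕ} (b : Fin (n + 1) → B) (d d' : HomotopyIndex B n)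
    (h : homotopyOrder ε b d d') : ¬ homotopyOrder ε b d' d := by
  rcases d with j | ⟨τ, j⟩ | τ <;> rcases d' with j' | ⟨τ', j'⟩ | τ' <;>
    simp only [homotopyOrder, not_false_eq_true] at h ⊢
  · exact orient_lt_asymm ε _ _ h
  · exact h.not_gt
  · exact h.not_ge
  · rintro (h' | ⟨rfl, h'⟩)
    · rcases h with h | ⟨rfl, -⟩
      · exact revInclusion_asymm _ _ h h'
      · exact revInclusion_asymm _ _ h' h'
    · rcases h with h | ⟨-, h⟩
      · exact revInclusion_asymm _ _ h h
      · exact orient_lt_asymm ε _ _ h h'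
  · exact revInclusion_asymm _ _ h

/-- The one statement serves both gluing (`γ` the identity, `θ` a simplicial operator) and
equivariance (`θ` the identity). Equality can occur because `θ` may collapse vertices. -/
theorem homotopyOrder_map {ε : Bool} {m n : ℕ} {b : Fin (m + 1) → B} {b' : Fin (n + 1) → B}
    (γ : B ≃o B) {θ : Fin (m + 1) → Fin (n + 1)} (hθ : Monotone θ) (hγ : b' ∘ θ = γ ∘ b)
    {d d' : HomotopyIndex B m} (h : homotopyOrder ε b d d') :
    Sum.map θ (Sum.map (Prod.map (ChainSet.map γ) θ) (ChainSet.map γ)) d =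
      Sum.map θ (Sum.map (Prod.map (ChainSet.map γ) θ) (ChainSet.map γ)) d' ∨
    homotopyOrder ε b' (Sum.map θ (Sum.map (Prod.map (ChainSet.map γ) θ) (ChainSet.map γ)) d)
      (Sum.map θ (Sum.map (Prod.map (ChainSet.map γ) θ) (ChainSet.map γ)) d') := by
  have hbθ : ∀ j, b' (θ j) = γ (b j) := fun j => congrFun hγ j
  have hlt : ∀ j j', orient ε (· < ·) j j' → θ j = θ j' ∨ orient ε (· < ·) (θ j) (θ j') := by
    cases ε
    · exact fun j j' h => (hθ (le_of_lt h)).eq_or_lt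
    · exact fun j j' h => (hθ (le_of_lt h)).eq_or_lt.imp_left Eq.symm
  rcases d with j | ⟨τ, j⟩ | τ <;> rcases d' with j' | ⟨τ', j'⟩ | τ' <;>
    simp only [homotopyOrder, Sum.map_inl, Sum.map_inr, Prod.map_apply, reduceCtorEq, false_or,
      ChainSet.bot_map, hbθ, γ.le_iff_le, γ.lt_iff_lt, ChainSet.map_subset_map, revInclusion,
      ChainSet.map_ssubset_map, Sum.inl.injEq, Sum.inr.injEq, Prod.mk.injEq,
      (ChainSet.map_injective γ).eq_iff] at h ⊢
  · exact hlt _ _ h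
  · exact h
  · exact h
  · rcases h with h | ⟨rfl, h⟩
    · exact Or.inr (Or.inl h)
    · exact (hlt _ _ h).imp (fun h => ⟨rfl, h⟩) (fun h => Or.inr ⟨rfl, h⟩)
  · exact h
  · exact Or.inr h

/-- The share of the weights that has left the vertices of the simplex. -/
noncomputable def homotopyShare (r : ℝ) : ℝ := min 1 (2 * r)

/-- The share of the weight of `τ` that has been moved to the subdivision. -/
noncomputable def homotopyMoved [Fintype B] (r : ℝ) (τ : ChainSet B) : ℝ :=
  max 0 (min 1 (Fintype.card B * max 0 (2 * r - 1) - (τ.1.card - 1)))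

theorem ChainSet.one_le_card (τ : ChainSet B) : (1 : ℝ) ≤ τ.1.card := by
  exact_mod_cast Finset.card_pos.mpr τ.2.1

section Weights

variable [Fintype B]

theorem homotopyShare_zero : homotopyShare 0 = 0 := by simp [homotopyShare]
theorem homotopyShare_one : homotopyShare 1 = 1 := by norm_num [homotopyShare]
theorem homotopyShare_nonneg {r : ℝ} (hr : 0 ≤ r) : 0 ≤ homotopyShare r :=
  le_min zero_le_one (by positivity)
theorem homotopyShare_le_one (r : ℝ) : homotopyShare r ≤ 1 := min_le_left _ _
theorem homotopyMoved_nonneg (r : ℝ) (τ : ChainSet B) : 0 ≤ homotopyMoved r τ := le_max_left _ _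
theorem homotopyMoved_le_one (r : ℝ) (τ : ChainSet B) : homotopyMoved r τ ≤ 1 :=
  max_le zero_le_one (min_le_left _ _)

theorem ChainSet.card_le (τ : ChainSet B) : (τ.1.card : ℝ) ≤ Fintype.card B := by
  exact_mod_cast Finset.card_le_univ τ.1

/-- The factor `Fintype.card B` makes the second stage long enough for a chain of every possible
length to be moved completely. -/
theorem homotopyMoved_one (τ : ChainSet B) : homotopyMoved 1 τ = 1 := by
  have := τ.card_le
  unfold homotopyMoved
  rw [min_eq_left, max_eq_right] <;> norm_num
  linarith

/-- The second stage starts only when the simplex vertices have lost all their weight, so these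
never occur together with vertices labelled by `c`. -/
theorem homotopyMoved_eq_zero {r : ℝ} (hr : homotopyShare r < 1) (τ : ChainSet B) :
    homotopyMoved r τ = 0 := by
  have := τ.one_le_card
  have h2 : 2 * r < 1 := by
    unfold homotopyShare at hr
    rcases min_lt_iff.mp hr with h | h
    · exact absurd h (lt_irrefl _)
    · exact h
  unfold homotopyMoved
  rw [max_eq_left (b := 2 * r - 1) (by linarith), max_eq_left]
  exact (min_le_right _ _).trans (by linarith)

/-- Shorter chains move first: a chain starts only after its proper subchains have finished, as
cardinality delays the start by whole units. The moved chains are thus contained in the unmoved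
ones, which is what makes their labels comparable. -/
theorem homotopyMoved_eq_one {r : ℝ} {τ τ' : ChainSet B} (h : revInclusion τ τ')
    (hτ : 0 < homotopyMoved r τ) : homotopyMoved r τ' = 1 := by
  have h1 : (τ'.1.card : ℝ) + 1 ≤ τ.1.card := by
    exact_mod_cast Nat.succ_le_of_lt (Finset.card_lt_card h)
  unfold homotopyMoved at hτ ⊢
  rcases lt_max_iff.mp hτ with h2 | h2
  · exact absurd h2 (lt_irrefl _)
  · have := (lt_min_iff.mp h2).2
    rw [min_eq_left (by linarith), max_eq_right zero_le_one]

open Classical in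
/-- The weights of the homotopy at time `r`. -/
noncomputable def homotopyWeight {n : ℕ} (b : Fin (n + 1) → B) (r : ℝ)
    (t : stdSimplex ℝ (Fin (n + 1))) : HomotopyIndex B n → ℝ
  | Sum.inl j => (1 - homotopyShare r) * t j
  | Sum.inr (Sum.inl (τ, j)) =>
      if b j = τ.bot then homotopyShare r * (t j * ChainSet.coef (stdSimplex.map b t) τ *
        (1 - homotopyMoved r τ)) / ChainSet.total (stdSimplex.map b t) else 0
  | Sum.inr (Sum.inr τ) =>
      homotopyShare r * (stdSimplex.map b t τ.bot * ChainSet.coef (stdSimplex.map b t) τ *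
        homotopyMoved r τ) / ChainSet.total (stdSimplex.map b t)

theorem total_map_pos {n : ℕ} {b : Fin (n + 1) → B} (hb : ∀ j j', b j ≤ b j' ∨ b j' ≤ b j)
    (t : stdSimplex ℝ (Fin (n + 1))) : 0 < ChainSet.total (stdSimplex.map b t) :=
  ChainSet.total_pos (stdSimplex.zero_le _) (stdSimplex.exists_pos _) (isChain_support hb t)

theorem homotopyWeight_mem {n : ℕ} {b : Fin (n + 1) → B} (hb : ∀ j j', b j ≤ b j' ∨ b j' ≤ b j)
    {r : ℝ} (hr : 0 ≤ r) (t : stdSimplex ℝ (Fin (n + 1))) :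
    homotopyWeight b r t ∈ stdSimplex ℝ (HomotopyIndex B n) := by
  classical
  have hN := total_map_pos hb t
  have hcoef := ChainSet.coef_nonneg (stdSimplex.zero_le (stdSimplex.map b t))
  have hs := homotopyShare_nonneg hr
  have hs1 := homotopyShare_le_one r
  constructor
  · rintro (j | ⟨τ, j⟩ | τ)
    · exact mul_nonneg (by linarith) (stdSimplex.zero_le t j)
    · simp only [homotopyWeight]
      split_ifs
      · exact div_nonneg (mul_nonneg hs (mul_nonneg (mul_nonneg (stdSimplex.zero_le t j) (hcoef τ))
          (sub_nonneg.mpr (homotopyMoved_le_one r τ)))) hN.le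
      · exact le_rfl
    · exact div_nonneg (mul_nonneg hs (mul_nonneg (mul_nonneg (stdSimplex.zero_le _ _) (hcoef τ))
        (homotopyMoved_nonneg r τ))) hN.le
  · rw [Fintype.sum_sum_type, Fintype.sum_sum_type, Fintype.sum_prod_type, ← Finset.sum_add_distrib]
    -- The weight at `τ.bot` is the sum of the `t j` with `b j = τ.bot`. This is why the subdivision
    -- weights carry the factor `u τ.bot`: the mass of `τ` can be shared among these `j`, with no
    -- choice of an object over `τ.bot`.
    have h1 : ∀ τ : ChainSet B, (∑ j, homotopyWeight b r t (Sum.inr (Sum.inl (τ, j)))) +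
        homotopyWeight b r t (Sum.inr (Sum.inr τ)) =
        homotopyShare r / ChainSet.total (stdSimplex.map b t) *
          (stdSimplex.map b t τ.bot * ChainSet.coef (stdSimplex.map b t) τ) := by
      intro τ
      have h2 : stdSimplex.map b t τ.bot = ∑ j, if b j = τ.bot then t j else 0 := by
        rw [stdSimplex.map_apply, Finset.sum_filter]
      have h3 : ∀ j, homotopyWeight b r t (Sum.inr (Sum.inl (τ, j))) =
          (if b j = τ.bot then t j else 0) * (homotopyShare r *
            (ChainSet.coef (stdSimplex.map b t) τ * (1 - homotopyMoved r τ)) /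
              ChainSet.total (stdSimplex.map b t)) := by
        intro j
        simp only [homotopyWeight]
        split_ifs <;> ring
      rw [Finset.sum_congr rfl fun j _ => h3 j, ← Finset.sum_mul, ← h2]
      simp only [homotopyWeight]
      ring
    rw [Finset.sum_congr rfl fun τ _ => h1 τ, ← Finset.mul_sum]
    change _ + _ * ChainSet.total (stdSimplex.map b t) = 1
    rw [div_mul_cancel₀ _ hN.ne']
    simp only [homotopyWeight]
    rw [← Finset.mul_sum, stdSimplex.sum_eq_one]
    ring

/-- The weights of the homotopy at time `r`, as a point of a simplex. -/
noncomputable def homotopyWeights {n : ℕ} {b : Fin (n + 1) → B}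
    (hb : ∀ j j', b j ≤ b j' ∨ b j' ≤ b j) (r : unitInterval) (t : stdSimplex ℝ (Fin (n + 1))) :
    stdSimplex ℝ (HomotopyIndex B n) :=
  ⟨homotopyWeight b r t, homotopyWeight_mem hb r.2.1 t⟩

theorem homotopyWeights_apply {n : ℕ} {b : Fin (n + 1) → B}
    (hb : ∀ j j', b j ≤ b j' ∨ b j' ≤ b j) (r : unitInterval) (t : stdSimplex ℝ (Fin (n + 1)))
    (d : HomotopyIndex B n) : homotopyWeights hb r t d = homotopyWeight b r t d := rfl

theorem continuous_homotopyWeights {n : ℕ} {b : Fin (n + 1) → B}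
    (hb : ∀ j j', b j ≤ b j' ∨ b j' ≤ b j) :
    Continuous fun p : stdSimplex ℝ (Fin (n + 1)) × unitInterval => homotopyWeights hb p.2 p.1 := by
  have hm : Continuous fun p : stdSimplex ℝ (Fin (n + 1)) × unitInterval =>
      (stdSimplex.map b p.1 : B → ℝ) :=
    continuous_subtype_val.comp ((stdSimplex.continuous_map b).comp continuous_fst)
  have ht : ∀ j, Continuous fun p : stdSimplex ℝ (Fin (n + 1)) × unitInterval => p.1 j := fun j =>
    (continuous_apply j).comp (continuous_subtype_val.comp continuous_fst)
  have hr : Continuous fun p : stdSimplex ℝ (Fin (n + 1)) × unitInterval => (p.2 : ℝ) :=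
    continuous_subtype_val.comp continuous_snd
  have hs : Continuous fun p : stdSimplex ℝ (Fin (n + 1)) × unitInterval =>
      homotopyShare p.2 := by
    unfold homotopyShare
    fun_prop
  have hq : ∀ τ : ChainSet B, Continuous fun p : stdSimplex ℝ (Fin (n + 1)) × unitInterval =>
      homotopyMoved p.2 τ := fun τ => by
    unfold homotopyMoved
    fun_prop
  have hcoef : ∀ τ : ChainSet B, Continuous fun p : stdSimplex ℝ (Fin (n + 1)) × unitInterval =>
      ChainSet.coef (stdSimplex.map b p.1) τ := fun τ => (ChainSet.continuous_coef τ).comp hm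
  have hN : Continuous fun p : stdSimplex ℝ (Fin (n + 1)) × unitInterval =>
      ChainSet.total (stdSimplex.map b p.1) := ChainSet.continuous_total.comp hm
  refine Continuous.subtype_mk (continuous_pi fun d => ?_) _
  rcases d with j | ⟨τ, j⟩ | τ <;> simp only [homotopyWeight]
  · exact (continuous_const.sub hs).mul (ht j)
  · split_ifs
    · exact (hs.mul (((ht j).mul (hcoef τ)).mul (continuous_const.sub (hq τ)))).div hN
        fun p => (total_map_pos hb p.1).ne'
    · exact continuous_const
  · exact (hs.mul ((((continuous_apply _).comp hm).mul (hcoef τ)).mul (hq τ))).div hN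
      fun p => (total_map_pos hb p.1).ne'

theorem homotopyWeights_zero {n : ℕ} {b : Fin (n + 1) → B}
    (hb : ∀ j j', b j ≤ b j' ∨ b j' ≤ b j) (t : stdSimplex ℝ (Fin (n + 1))) :
    homotopyWeights hb 0 t = stdSimplex.map Sum.inl t := by
  classical
  ext d
  rw [homotopyWeights_apply, stdSimplex.map_apply, Finset.sum_filter]
  rcases d with j | ⟨τ, j⟩ | τ <;> simp [homotopyWeight, homotopyShare_zero]

theorem homotopyWeights_one {n : ℕ} {b : Fin (n + 1) → B}
    (hb : ∀ j j', b j ≤ b j' ∨ b j' ≤ b j) (t : stdSimplex ℝ (Fin (n + 1))) :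
    homotopyWeights hb 1 t = stdSimplex.map (fun τ => Sum.inr (Sum.inr τ))
      (ChainSet.bary (stdSimplex.map b t) (isChain_support hb t)) := by
  classical
  ext d
  rw [homotopyWeights_apply, stdSimplex.map_apply, Finset.sum_filter]
  rcases d with j | ⟨τ, j⟩ | τ <;>
    simp [homotopyWeight, homotopyShare_one, homotopyMoved_one, ChainSet.bary_apply]

/-- All ingredients are invariant under `γ`, and weights `t j` with the same image under `θ` add up
linearly in the first two kinds of vertices. -/
theorem homotopyWeights_map {m n : ℕ} {b : Fin (m + 1) → B} {b' : Fin (n + 1) → B}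
    (hb : ∀ j j', b j ≤ b j' ∨ b j' ≤ b j) (hb' : ∀ j j', b' j ≤ b' j' ∨ b' j' ≤ b' j)
    (γ : B ≃o B) {θ : Fin (m + 1) → Fin (n + 1)} (hγ : b' ∘ θ = γ ∘ b) (r : unitInterval)
    (t : stdSimplex ℝ (Fin (m + 1))) :
    stdSimplex.map (Sum.map θ (Sum.map (Prod.map (ChainSet.map γ) θ) (ChainSet.map γ)))
      (homotopyWeights hb r t) = homotopyWeights hb' r (stdSimplex.map θ t) := by
  classical
  have hu : stdSimplex.map b' (stdSimplex.map θ t) = stdSimplex.map γ (stdSimplex.map b t) := by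
    rw [stdSimplex.map_comp_apply, stdSimplex.map_comp_apply, hγ]
  have hN : ChainSet.total (stdSimplex.map γ (stdSimplex.map b t)) =
      ChainSet.total (stdSimplex.map b t) := by
    rw [← ChainSet.total_map γ, ChainSet.map_comp_orderIso]
  have hcoef : ∀ τ : ChainSet B, ChainSet.coef (stdSimplex.map γ (stdSimplex.map b t)) (τ.map γ) =
      ChainSet.coef (stdSimplex.map b t) τ := fun τ => by
    rw [ChainSet.coef_map, ChainSet.map_comp_orderIso]
  have hq : ∀ τ : ChainSet B, homotopyMoved (r : ℝ) (τ.map γ) = homotopyMoved (r : ℝ) τ :=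
    fun τ => by rw [homotopyMoved, ChainSet.card_map, homotopyMoved]
  have hbθ : ∀ j, b' (θ j) = γ (b j) := fun j => congrFun hγ j
  ext d
  rw [homotopyWeights_apply, stdSimplex.map_apply, Finset.sum_filter, Fintype.sum_sum_type,
    Fintype.sum_sum_type, Fintype.sum_prod_type]
  rcases d with j | ⟨τ, j⟩ | τ
  · simp [homotopyWeight, homotopyWeights_apply, stdSimplex.map_apply, Finset.mul_sum,
      Finset.sum_filter]
  · obtain ⟨τ, rfl⟩ := ChainSet.map_surjective γ τ
    simp only [homotopyWeight, homotopyWeights_apply, Sum.map_inl, Sum.map_inr, reduceCtorEq,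
      if_false, Finset.sum_const_zero, zero_add, add_zero, Sum.inr.injEq, Sum.inl.injEq,
      Prod.map_apply, Prod.mk.injEq, (ChainSet.map_injective γ).eq_iff, hu, hN, hcoef, hq,
      ChainSet.bot_map]
    rw [Finset.sum_eq_single τ (fun τ' _ hne => by simp [hne]) (by simp), stdSimplex.map_apply,
      Finset.sum_filter]
    split_ifs with h
    · simp only [true_and, Finset.sum_mul, Finset.mul_sum, Finset.sum_div]
      refine Finset.sum_congr rfl fun j' _ => ?_
      by_cases hj : θ j' = j
      · subst hj
        rw [hbθ] at h
        simp [γ.injective h]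
      · simp [hj]
    · refine Finset.sum_eq_zero fun j' _ => ?_
      by_cases hj : θ j' = j
      · subst hj
        rw [hbθ] at h
        rw [if_neg (c := b j' = τ.bot) fun h' => h (congrArg γ h')]
        simp
      · simp [hj]
  · obtain ⟨τ, rfl⟩ := ChainSet.map_surjective γ τ
    simp only [homotopyWeight, homotopyWeights_apply, Sum.map_inl, Sum.map_inr, reduceCtorEq,
      if_false, Finset.sum_const_zero, zero_add, Sum.inr.injEq,
      (ChainSet.map_injective γ).eq_iff, hu, hN, hcoef, hq, ChainSet.bot_map,
      stdSimplex.map_apply_of_injective γ.injective]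
    simp

end Weights

end SubdivisionHomotopy

/-! ### The support of the homotopy weights is a chain -/

section SubdivisionHomotopyMap

variable {B : Type*} [PartialOrder B] [Fintype B] {A : Type u} [Category.{u} A]

theorem homotopyWeight_inl_pos {n : ℕ} {b : Fin (n + 1) → B} {r : ℝ}
    {t : stdSimplex ℝ (Fin (n + 1))} {j : Fin (n + 1)} (h : 0 < homotopyWeight b r t (Sum.inl j)) :
    homotopyShare r < 1 := by
  refine (homotopyShare_le_one r).lt_of_ne fun h1 => h.ne' ?_
  simp [homotopyWeight, h1]

theorem homotopyWeight_mid_pos {n : ℕ} {b : Fin (n + 1) → B} {r : ℝ}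
    {t : stdSimplex ℝ (Fin (n + 1))} {τ : ChainSet B} {j : Fin (n + 1)}
    (h : 0 < homotopyWeight b r t (Sum.inr (Sum.inl (τ, j)))) :
    b j = τ.bot ∧ 0 < ChainSet.coef (stdSimplex.map b t) τ ∧ homotopyMoved r τ < 1 := by
  classical
  refine ⟨?_, (ChainSet.coef_nonneg (stdSimplex.zero_le _) τ).lt_of_ne' fun h1 => h.ne' ?_,
    (homotopyMoved_le_one r τ).lt_of_ne fun h1 => h.ne' ?_⟩
  · by_contra h1
    exact h.ne' (by simp [homotopyWeight, h1])
  · simp [homotopyWeight, h1, -stdSimplex.map_coe]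
  · simp [homotopyWeight, h1]

theorem homotopyWeight_inr_pos {n : ℕ} {b : Fin (n + 1) → B} {r : ℝ}
    {t : stdSimplex ℝ (Fin (n + 1))} {τ : ChainSet B}
    (h : 0 < homotopyWeight b r t (Sum.inr (Sum.inr τ))) :
    0 < ChainSet.coef (stdSimplex.map b t) τ ∧ 0 < homotopyMoved r τ := by
  refine ⟨(ChainSet.coef_nonneg (stdSimplex.zero_le _) τ).lt_of_ne' fun h1 => h.ne' ?_,
    (homotopyMoved_nonneg r τ).lt_of_ne' fun h1 => h.ne' ?_⟩ <;>
  simp [homotopyWeight, h1, -stdSimplex.map_coe]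

theorem ChainSet.exists_eq_bot {n : ℕ} {b : Fin (n + 1) → B} {t : stdSimplex ℝ (Fin (n + 1))}
    {τ : ChainSet B} (h : 0 < ChainSet.coef (stdSimplex.map b t) τ) : ∃ j, b j = τ.bot := by
  have h1 := ((ChainSet.coef_pos_iff (stdSimplex.zero_le _)).mp h).1 _ τ.bot_mem
  obtain ⟨j, -, hj⟩ := stdSimplex.exists_of_map_apply_pos b h1
  exact ⟨j, hj⟩

/-- The objects labelling the vertices of the homotopy. -/
def homotopyLabel {n : ℕ} (a : Fin (n + 1) → A) (c : ChainSet B → A) : HomotopyIndex B n → A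
  | Sum.inl j => a j
  | Sum.inr (Sum.inl (_, j)) => a j
  | Sum.inr (Sum.inr τ) => c τ

/-- On the support, the chains are nested and each least element is one of the comparable `b j`. The
timing of the two stages excludes the remaining incomparable pairs. -/
theorem homotopyOrder_total {ε : Bool} {n : ℕ} {b : Fin (n + 1) → B}
    (hb : ∀ j j', b j ≤ b j' ∨ b j' ≤ b j) {r : ℝ} {t : stdSimplex ℝ (Fin (n + 1))}
    {d d' : HomotopyIndex B n} (hd : 0 < homotopyWeight b r t d)
    (hd' : 0 < homotopyWeight b r t d') (hne : d ≠ d') :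
    homotopyOrder ε b d d' ∨ homotopyOrder ε b d' d := by
  have hlt : ∀ j j' : Fin (n + 1), j ≠ j' → orient ε (· < ·) j j' ∨ orient ε (· < ·) j' j := by
    intro j j' h
    cases ε
    · exact lt_or_gt_of_ne h
    · exact (lt_or_gt_of_ne h).symm
  have hbot : ∀ (j : Fin (n + 1)) (τ : ChainSet B), 0 < ChainSet.coef (stdSimplex.map b t) τ →
      b j ≤ τ.bot ∨ τ.bot < b j := by
    intro j τ hτ
    obtain ⟨j', hj'⟩ := ChainSet.exists_eq_bot hτ
    rw [← hj']
    rcases hb j j' with h | h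
    · exact Or.inl h
    · rcases h.eq_or_lt with h | h
      · exact Or.inl h.ge
      · exact Or.inr h
  have hnest : ∀ τ τ' : ChainSet B, 0 < ChainSet.coef (stdSimplex.map b t) τ →
      0 < ChainSet.coef (stdSimplex.map b t) τ' →
        revInclusion τ τ' ∨ τ = τ' ∨ revInclusion τ' τ := by
    intro τ τ' h h'
    rcases ChainSet.subset_or_subset (stdSimplex.zero_le _) h h' with hs | hs
    · rcases ChainSet.eq_or_revInclusion hs with h1 | h1
      · exact Or.inr (Or.inl h1.symm)
      · exact Or.inr (Or.inr h1)
    · rcases ChainSet.eq_or_revInclusion hs with h1 | h1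
      · exact Or.inr (Or.inl h1)
      · exact Or.inl h1
  -- If `τ` were a proper subchain of `τ'`, it would have finished moving before `τ'` began.
  have hmidbary : ∀ τ τ' : ChainSet B, 0 < ChainSet.coef (stdSimplex.map b t) τ →
      homotopyMoved r τ < 1 → 0 < ChainSet.coef (stdSimplex.map b t) τ' →
      0 < homotopyMoved r τ' → τ'.1 ⊆ τ.1 := by
    intro τ τ' h h1 h' h1'
    rcases hnest τ τ' h h' with h2 | rfl | h2
    · exact h2.subset
    · exact subset_rfl
    · exact absurd (homotopyMoved_eq_one h2 h1') h1.ne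
  have hinlbary : ∀ (j : Fin (n + 1)) (τ : ChainSet B), 0 < homotopyWeight b r t (Sum.inl j) →
      ¬ 0 < homotopyWeight b r t (Sum.inr (Sum.inr τ)) := by
    intro j τ h h'
    exact (homotopyWeight_inr_pos h').2.ne' (homotopyMoved_eq_zero (homotopyWeight_inl_pos h) τ)
  rcases d with j | ⟨τ, j⟩ | τ <;> rcases d' with j' | ⟨τ', j'⟩ | τ'
  · exact hlt j j' fun h => hne (congrArg _ h)
  · exact hbot j τ' (homotopyWeight_mid_pos hd').2.1
  · exact absurd hd' (hinlbary _ _ hd)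
  · exact (hbot j' τ (homotopyWeight_mid_pos hd).2.1).symm
  · rcases hnest τ τ' (homotopyWeight_mid_pos hd).2.1 (homotopyWeight_mid_pos hd').2.1
      with h | rfl | h
    · exact Or.inl (Or.inl h)
    · have hj : j ≠ j' := by
        rintro rfl
        exact hne rfl
      exact (hlt j j' hj).imp (fun h => Or.inr ⟨rfl, h⟩) (fun h => Or.inr ⟨rfl, h⟩)
    · exact Or.inr (Or.inl h)
  · obtain ⟨-, h1, h2⟩ := homotopyWeight_mid_pos hd
    obtain ⟨h1', h2'⟩ := homotopyWeight_inr_pos hd'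
    exact Or.inl (hmidbary τ τ' h1 h2 h1' h2')
  · exact absurd hd (hinlbary _ _ hd')
  · obtain ⟨-, h1, h2⟩ := homotopyWeight_mid_pos hd'
    obtain ⟨h1', h2'⟩ := homotopyWeight_inr_pos hd
    exact Or.inr (hmidbary τ' τ h1 h2 h1' h2')
  · rcases hnest τ τ' (homotopyWeight_inr_pos hd).1 (homotopyWeight_inr_pos hd').1 with h | rfl | h
    · exact Or.inl h
    · exact absurd rfl hne
    · exact Or.inr h

theorem homotopyOrder_trans {ε : Bool} {n : ℕ} {b : Fin (n + 1) → B}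
    (hb : ∀ j j', orient ε (· < ·) j j' → b j ≤ b j')
    (hb' : ∀ j j', b j < b j' → orient ε (· < ·) j j') {r : ℝ}
    {t : stdSimplex ℝ (Fin (n + 1))} {d d' d'' : HomotopyIndex B n}
    (hd : 0 < homotopyWeight b r t d) (hd' : 0 < homotopyWeight b r t d')
    (hd'' : 0 < homotopyWeight b r t d'') (h : homotopyOrder ε b d d')
    (h' : homotopyOrder ε b d' d'') : homotopyOrder ε b d d'' := by
  have hlt : ∀ j j' j'' : Fin (n + 1), orient ε (· < ·) j j' → orient ε (· < ·) j' j'' →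
      orient ε (· < ·) j j'' := by
    cases ε
    · exact fun j j' j'' h h' => lt_trans (α := Fin (n + 1)) h h'
    · exact fun j j' j'' h h' => lt_trans (α := Fin (n + 1)) h' h
  have hrev : ∀ τ τ' τ'' : ChainSet B, revInclusion τ τ' → revInclusion τ' τ'' →
      revInclusion τ τ'' := fun _ _ _ h h' => LT.lt.trans h' h
  have hinlbary : ∀ (j : Fin (n + 1)) (τ : ChainSet B), 0 < homotopyWeight b r t (Sum.inl j) →
      ¬ 0 < homotopyWeight b r t (Sum.inr (Sum.inr τ)) := by
    intro j τ h h'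
    exact (homotopyWeight_inr_pos h').2.ne' (homotopyMoved_eq_zero (homotopyWeight_inl_pos h) τ)
  have hle : ∀ {τ τ' : ChainSet B} {j j' : Fin (n + 1)},
      (revInclusion τ τ' ∨ τ = τ' ∧ orient ε (· < ·) j j') → τ'.1 ⊆ τ.1 := by
    rintro τ τ' j j' (h | ⟨rfl, -⟩)
    · exact h.subset
    · exact subset_rfl
  rcases d with j | ⟨τ, j⟩ | τ <;> rcases d' with j' | ⟨τ', j'⟩ | τ' <;>
    rcases d'' with j'' | ⟨τ'', j''⟩ | τ'' <;> simp only [homotopyOrder] at h h' ⊢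
  · exact hlt _ _ _ h h'
  · exact (hb _ _ h).trans h'
  · exact hb' _ _ (h.trans_lt h')
  · exact h.trans (ChainSet.bot_le_bot (hle h'))
  · exact absurd hd'' (hinlbary _ _ hd)
  · exact h.trans_le (hb _ _ h')
  -- Two chains separated by a simplex vertex have strictly increasing least elements; being nested,
  -- the first must properly contain the second.
  · obtain ⟨-, h1, -⟩ := homotopyWeight_mid_pos hd
    obtain ⟨-, h2, -⟩ := homotopyWeight_mid_pos hd''
    have h3 : τ.bot < τ''.bot := h.trans_le h'
    rcases ChainSet.subset_or_subset (stdSimplex.zero_le _) h1 h2 with hs | hs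
    · exact absurd (ChainSet.bot_le_bot hs) h3.not_ge
    · rcases ChainSet.eq_or_revInclusion hs with rfl | h4
      · exact absurd h3 (lt_irrefl _)
      · exact Or.inl h4
  · exact (ChainSet.bot_le_bot (hle h)).trans_lt h'
  · rcases h with h | ⟨rfl, h⟩
    · rcases h' with h' | ⟨rfl, h'⟩
      · exact Or.inl (hrev _ _ _ h h')
      · exact Or.inl h
    · rcases h' with h' | ⟨rfl, h'⟩
      · exact Or.inl h'
      · exact Or.inr ⟨rfl, hlt _ _ _ h h'⟩
  · exact h'.trans (hle h)
  · exact h'.subset.trans h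
  · exact hrev _ _ _ h h'

variable [Quiver.IsThin A]

/-- On the support a middle vertex `(τ, j)` has label over `τ.bot`. Labels therefore increase along
the order, by monotonicity of `bot` and `c`; the passage from a middle vertex to a moved one uses
`τ.bot ≤ τ'.bot ≤ i (c τ')`. -/
theorem exists_homotopy_isWeightedPoint {ε : Bool} {i : A → B}
    (hi : ∀ x y, orient ε HasArrow x y ↔ i x ≤ i y) {c : ChainSet B → A}
    (hc : ∀ τ τ' : ChainSet B, τ'.1 ⊆ τ.1 → i (c τ) ≤ i (c τ')) (hbot : ∀ τ, τ.bot ≤ i (c τ))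
    {n : ℕ} {a : Fin (n + 1) → A} (h : IsObjChain a)
    (hb : ∀ j j', (i ∘ a) j ≤ (i ∘ a) j' ∨ (i ∘ a) j' ≤ (i ∘ a) j)
    (r : unitInterval) (t : stdSimplex ℝ (Fin (n + 1))) :
    ∃ x, IsWeightedPoint (orient ε (homotopyOrder ε (i ∘ a))) (homotopyLabel a c)
      (homotopyWeights hb r t) x := by
  have hle : ∀ j j', orient ε (· < ·) j j' → i (a j) ≤ i (a j') := by
    intro j j' hj
    rw [← hi]
    exact orient_mono ε (fun _ _ hd => h _ _ (le_of_lt hd)) hj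
  have hlt : ∀ j j', i (a j) < i (a j') → orient ε (· < ·) j j' := by
    intro j j' hj
    have hnot : ¬ orient ε (· < ·) j' j := fun h' => (hle _ _ h').not_gt hj
    have hne : j ≠ j' := by
      rintro rfl
      exact lt_irrefl _ hj
    cases ε
    · exact (lt_or_gt_of_ne hne).resolve_right hnot
    · exact (lt_or_gt_of_ne hne).resolve_left hnot
  refine exists_isWeightedPoint_orient ε (homotopyOrder_asymm ε _)
    (fun d d' hd hd' hne => homotopyOrder_total hb hd hd' hne)
    (fun d d' d'' hd hd' hd'' e e' => homotopyOrder_trans hle hlt hd hd' hd'' e e')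
    fun d d' hd hd' e => (hi _ _).mpr ?_
  rcases d with j | ⟨τ, j⟩ | τ <;> rcases d' with j' | ⟨τ', j'⟩ | τ' <;>
    simp only [homotopyOrder, homotopyLabel] at e ⊢
  · exact hle _ _ e
  · have h1 : i (a j') = τ'.bot := (homotopyWeight_mid_pos hd').1
    rw [h1]
    exact e
  · have h1 : i (a j) = τ.bot := (homotopyWeight_mid_pos hd).1
    rw [h1]
    exact e.le
  · have h1 : i (a j) = τ.bot := (homotopyWeight_mid_pos hd).1
    have h1' : i (a j') = τ'.bot := (homotopyWeight_mid_pos hd').1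
    rw [h1, h1']
    rcases e with e | ⟨rfl, -⟩
    · exact ChainSet.bot_le_bot e.subset
    · exact le_rfl
  · have h1 : i (a j) = τ.bot := (homotopyWeight_mid_pos hd).1
    rw [h1]
    exact (ChainSet.bot_le_bot e).trans (hbot _)
  · exact hc _ _ e.subset

end SubdivisionHomotopyMap

/-! ### A criterion for equivariant homotopy equivalences -/

section Criterion

theorem ChainSet.map_refl {B : Type*} [PartialOrder B] (τ : ChainSet B) :
    τ.map (OrderIso.refl B) = τ := ChainSet.ext (by ext; simp [ChainSet.map])

variable {B : Type*} [PartialOrder B] [Fintype B]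

/-- The homotopy is built as a map into the path space, so that it can be glued simplex by simplex
from curried pieces without a realization of a product with the interval. Naturality is stated for
all compatible pairs `γ`, `F` at once, so one homotopy serves every group element. -/
theorem IsSubdivisionMap.exists_homotopy {A : Type u} [Category.{u} A] [Quiver.IsThin A] {ε : Bool}
    {i : A → B} (hi : ∀ x y, orient ε HasArrow x y ↔ i x ≤ i y) {c : ChainSet B → A}
    (hc : ∀ τ τ' : ChainSet B, τ'.1 ⊆ τ.1 → i (c τ) ≤ i (c τ')) (hbot : ∀ τ, τ.bot ≤ i (c τ))
    {g : C(NerveSpace A, NerveSpace A)} (hg : IsSubdivisionMap ε i c g) :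
    ∃ H : C(NerveSpace A, C(unitInterval, NerveSpace A)),
      (∀ x, H x 0 = x) ∧ (∀ x, H x 1 = g x) ∧
      ∀ (γ : B ≃o B) (F : A ⥤ A), (∀ x, i (F.obj x) = γ (i x)) →
        (∀ τ, c (τ.map γ) = F.obj (c τ)) →
        ∀ r x, H (nerveSpaceMap F x) r = nerveSpaceMap F (H x r) := by
  have hi' : ∀ x y, HasArrow x y → orient ε (· ≤ ·) (i x) (i y) := fun x y h =>
    orient_mono (r := orient ε HasArrow) ε (fun x y => (hi x y).mp) ((orient_orient ε).mpr h)
  have key : ∀ (n : ℕ) (a : Fin (n + 1) → A) (h : IsObjChain a),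
      ∃ K : C(stdSimplex ℝ (Fin (n + 1)) × unitInterval, NerveSpace A), ∀ p,
        IsWeightedPoint (orient ε (homotopyOrder ε (i ∘ a))) (homotopyLabel a c)
          (homotopyWeights (h.comparable hi') p.2 p.1) (K p) := fun n a h =>
    exists_continuous_isWeightedPoint (orient_asymm ε (homotopyOrder_asymm ε _))
      ⟨_, continuous_homotopyWeights (h.comparable hi')⟩
      fun p => exists_homotopy_isWeightedPoint hi hc hbot h (h.comparable hi') p.2 p.1
  choose K hK using key
  -- Compatibility with simplicial operators and with the action in one: the first is used with `F`
  -- the identity, the second with `θ` the identity.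
  have nat : ∀ (m n : ℕ) (a : Fin (m + 1) → A) (h : IsObjChain a) (a' : Fin (n + 1) → A)
      (h' : IsObjChain a') (θ : Fin (m + 1) → Fin (n + 1)), Monotone θ → ∀ (γ : B ≃o B) (F : A ⥤ A),
      (∀ x, i (F.obj x) = γ (i x)) → (∀ τ, c (τ.map γ) = F.obj (c τ)) → a' ∘ θ = F.obj ∘ a →
      ∀ t r, nerveSpaceMap F (K m a h (t, r)) = K n a' h' (stdSimplex.map θ t, r) := by
    intro m n a h a' h' θ hθ γ F hF hcF e t r
    have eb : (i ∘ a') ∘ θ = γ ∘ i ∘ a := by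
      rw [Function.comp_assoc, e]
      exact funext fun j => hF (a j)
    refine ((hK m a h (t, r)).map F).eq_of_map_orient (homotopyOrder_asymm ε (i ∘ a'))
      (Sum.map θ (Sum.map (Prod.map (ChainSet.map γ) θ) (ChainSet.map γ))) ?_
      (fun d d' _ _ hd => homotopyOrder_map γ hθ eb hd) (f' := homotopyLabel a' c) ?_
    · rw [homotopyWeights_map (h.comparable hi') (h'.comparable hi') γ eb]
      exact hK n a' h' (stdSimplex.map θ t, r)
    · rintro (j | ⟨τ, j⟩ | τ) -
      · exact congrFun e j
      · exact congrFun e j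
      · exact hcF τ
  obtain ⟨H, hH⟩ := exists_nerveSpace_desc (fun n a h => (K n a h).curry)
    (fun m n a h θ hθ t => by
      ext r
      have := nat m n (a ∘ θ) (h.comp hθ) a h θ hθ (OrderIso.refl B) (𝟭 A) (fun _ => rfl)
        (fun τ => by rw [ChainSet.map_refl]; rfl) rfl t r
      rwa [nerveSpaceMap_id] at this)
  have hH' : ∀ (n : ℕ) (a : Fin (n + 1) → A) (h : IsObjChain a) (t : stdSimplex ℝ (Fin (n + 1)))
      (r : unitInterval), H (chainPoint h t) r = K n a h (t, r) := fun n a h t r => by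
    rw [hH]
    rfl
  have hev : ∀ r : unitInterval, Continuous fun x => H x r := fun r =>
    (continuous_eval_const r).comp H.continuous
  refine ⟨H, fun x => ?_, fun x => ?_, fun γ F hF hcF r x => ?_⟩
  · refine DFunLike.congr_fun (f := ⟨_, hev 0⟩) (g := ContinuousMap.id _)
      (nerveSpace_hom_ext fun n a h t => ?_) x
    refine (hH' n a h t 0).trans ?_
    have h1 := hK n a h (t, 0)
    rw [homotopyWeights_zero] at h1
    refine h1.unique (orient_asymm ε (homotopyOrder_asymm ε _)) ⟨n, Sum.inl, t, h, ?_, rfl, rfl⟩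
    intro j j' hj
    exact orient_mono (r := orient ε (· < ·)) ε (fun _ _ h => h) ((orient_orient ε).mpr hj)
  · refine DFunLike.congr_fun (f := ⟨_, hev 1⟩) (g := g) (nerveSpace_hom_ext fun n a h t => ?_) x
    refine (hH' n a h t 1).trans ?_
    have h1 := hK n a h (t, 1)
    rw [homotopyWeights_one] at h1
    exact ((hg n a h t (isChain_support (h.comparable hi') t)).eq_of_map_orient
      (homotopyOrder_asymm ε (i ∘ a)) _ h1 (fun τ τ' _ _ h => Or.inr h) (fun τ _ => rfl)).symm
  · refine DFunLike.congr_fun (f := ⟨fun x => H (nerveSpaceMap F x) r,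
      (hev r).comp (nerveSpaceMap F).continuous⟩) (g := ⟨fun x => nerveSpaceMap F (H x r),
      (nerveSpaceMap F).continuous.comp (hev r)⟩) (nerveSpace_hom_ext fun n a h t => ?_) x
    change H (nerveSpaceMap F (chainPoint h t)) r = nerveSpaceMap F (H (chainPoint h t) r)
    rw [nerveSpaceMap_chainPoint, hH', hH', nat n n a h _ (h.map F) id monotone_id γ F hF hcF rfl,
      stdSimplex.map_id_apply]

theorem nerveSpaceMap_comp_eq_comp {A A' : Type u} [Category.{u} A] [Quiver.IsThin A]
    [Category.{u} A'] [Quiver.IsThin A'] {F : A ⥤ A'} {P : A ⥤ A} {P' : A' ⥤ A'}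
    (h : ∀ x, F.obj (P.obj x) = P'.obj (F.obj x)) (x : NerveSpace A) :
    nerveSpaceMap F (nerveSpaceMap P x) = nerveSpaceMap P' (nerveSpaceMap F x) := by
  have : P ⋙ F = F ⋙ P' := CategoryTheory.Functor.ext h fun _ _ _ => Subsingleton.elim _ _
  have h2 := congrArg nerveSpaceMap this
  rw [nerveSpaceMap_comp, nerveSpaceMap_comp] at h2
  exact DFunLike.congr_fun h2 x

/-- A functor between preorders that reflects and preserves the order is an equivariant homotopy
equivalence if the chains of its target can be sent equivariantly and monotonically to objects of
its source lying above the least element of the chain. -/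
theorem isEquivariantHomotopyEquiv_of_chains {G : Type*} [Group G] (S : Subgroup G)
    {A A' : Type u} [Category.{u} A] [Quiver.IsThin A] [StrictAction G A] [Category.{u} A']
    [Quiver.IsThin A'] [StrictAction G A'] (F : A ⥤ A') (ε : Bool) (i : A' → B)
    (hi : ∀ x y, orient ε HasArrow x y ↔ i x ≤ i y)
    (hiF : ∀ x y, orient ε HasArrow x y ↔ i (F.obj x) ≤ i (F.obj y)) (γ : S → B ≃o B)
    (hγ : ∀ (s : S) x, i ((StrictAction.act (A := A') (s : G)).obj x) = γ s (i x))
    (hF : ∀ (s : S) x, F.obj ((StrictAction.act (A := A) (s : G)).obj x) =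
      (StrictAction.act (A := A') (s : G)).obj (F.obj x))
    (c : ChainSet B → A)
    (hcγ : ∀ (s : S) τ, c (τ.map (γ s)) = (StrictAction.act (A := A) (s : G)).obj (c τ))
    (hc : ∀ τ τ' : ChainSet B, τ'.1 ⊆ τ.1 → i (F.obj (c τ)) ≤ i (F.obj (c τ')))
    (hbot : ∀ τ, τ.bot ≤ i (F.obj (c τ))) :
    IsEquivariantHomotopyEquiv S (nerveSpaceMap F) := by
  have hi' : ∀ x y, HasArrow x y → orient ε (· ≤ ·) (i x) (i y) := fun x y h =>
    orient_mono (r := orient ε HasArrow) ε (fun x y => (hi x y).mp) ((orient_orient ε).mpr h)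
  obtain ⟨g, hg⟩ := exists_isSubdivisionMap hi' (c := c) fun τ τ' h => (hiF _ _).mpr (hc τ τ' h)
  have hgγ : ∀ (s : S) (y : NerveSpace A'), g (s • y) = s • g y := fun s y =>
    DFunLike.congr_fun (hg.comp_eq_comp hi' (γ s) (hγ s) (hcγ s)) y
  have hFγ : ∀ (s : S) (x : NerveSpace A), nerveSpaceMap F (s • x) = s • nerveSpaceMap F x :=
    fun s x => nerveSpaceMap_comp_eq_comp (hF s) x
  -- Both composites are subdivision maps: `g ∘ |F|` for `i ∘ F.obj` and `c`, and `|F| ∘ g` for `i`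
  -- and `F.obj ∘ c`. The homotopies start at the identity, hence the reversal of time below.
  obtain ⟨H, hH0, hH1, hH⟩ := (hg.comp F).exists_homotopy hiF hc hbot
  obtain ⟨H', hH0', hH1', hH'⟩ := (hg.map F).exists_homotopy hi hc hbot
  refine ⟨hFγ, g, hgγ, ⟨⟨⟨fun p => H p.2 (unitInterval.symm p.1), ?_⟩, fun x => ?_, fun x => ?_⟩,
    fun t s x => ?_⟩, ⟨⟨⟨fun p => H' p.2 (unitInterval.symm p.1), ?_⟩, fun x => ?_, fun x => ?_⟩,
    fun t s x => ?_⟩⟩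
  · exact H.uncurry.continuous.comp (f := fun p : unitInterval × NerveSpace A =>
      (p.2, unitInterval.symm p.1)) (by fun_prop)
  · simpa using hH1 x
  · simpa using hH0 x
  · exact hH (γ s) _ (fun x => (congrArg i (hF s x)).trans (hγ s _)) (hcγ s) _ x
  · exact H'.uncurry.continuous.comp (f := fun p : unitInterval × NerveSpace A' =>
      (p.2, unitInterval.symm p.1)) (by fun_prop)
  · simpa using hH1' x
  · simpa using hH0' x
  · exact hH' (γ s) _ (hγ s) (fun τ => (congrArg F.obj (hcγ s τ)).trans (hF s _)) _ x

end Criterion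

/-! ### Equivariant choice -/

section EquivariantChoice

/-- Choose on orbit representatives and transport along the orbit. Two transports differ by a
stabilizer element, which fixes the chosen value. -/
theorem exists_equivariant_section {K T X : Type*} [Group K] [MulAction K T] [MulAction K X]
    {P : T → X → Prop} (hP : ∀ (k : K) t x, P t x → P (k • t) (k • x))
    (h : ∀ t, ∃ x, P t x ∧ ∀ k : K, k • t = t → k • x = x) :
    ∃ c : T → X, (∀ t, P t (c t)) ∧ ∀ (k : K) t, c (k • t) = k • c t := by
  choose x₀ hx₀ hfix using h
  let rep : T → T := fun t => Quotient.out (Quotient.mk (MulAction.orbitRel K T) t)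
  have hrep : ∀ t, ∃ k : K, k • rep t = t := fun t =>
    MulAction.orbitRel_apply.mp ((MulAction.orbitRel K T).symm (Quotient.mk_out t))
  have hrep' : ∀ (k : K) t, rep (k • t) = rep t := fun k t =>
    congrArg Quotient.out (Quotient.sound (MulAction.orbitRel_apply.mpr ⟨k, rfl⟩))
  choose g hg using hrep
  refine ⟨fun t => g t • x₀ (rep t), fun t => ?_, fun k t => ?_⟩
  · have := hP (g t) _ _ (hx₀ (rep t))
    rwa [hg] at this
  · change g (k • t) • x₀ (rep (k • t)) = k • g t • x₀ (rep t)
    have h1 := hg (k • t)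
    rw [hrep'] at h1 ⊢
    have h2 : ((k * g t)⁻¹ * g (k • t)) • rep t = rep t := by
      rw [mul_smul, h1, inv_smul_eq_iff, mul_smul, hg]
    have h3 := hfix _ _ h2
    rwa [mul_smul, inv_smul_eq_iff, mul_smul] at h3

end EquivariantChoice

/-! ### Normalizers of chains of subgroups -/

section ChainNormalizer

variable {G : Type u} [Group G]

/-- The elements of `S` that normalize every member of `T`. -/
def chainNormalizer (S : Subgroup G) (T : Set (Subgroup G)) : Subgroup G :=
  S ⊓ ⨅ Q ∈ T, Subgroup.normalizer (Q : Set G)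

theorem mem_chainNormalizer {S : Subgroup G} {T : Set (Subgroup G)} {g : G} :
    g ∈ chainNormalizer S T ↔ g ∈ S ∧ ∀ Q ∈ T, g ∈ Subgroup.normalizer (Q : Set G) := by
  simp [chainNormalizer, Subgroup.mem_inf, Subgroup.mem_iInf]

theorem chainNormalizer_anti (S : Subgroup G) {T T' : Set (Subgroup G)} (h : T ⊆ T') :
    chainNormalizer S T' ≤ chainNormalizer S T := fun g hg => by
  rw [mem_chainNormalizer] at hg ⊢
  exact ⟨hg.1, fun Q hQ => hg.2 Q (h hQ)⟩

theorem mem_map_conj {Q : Subgroup G} {g x : G} :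
    x ∈ Q.map (MulAut.conj g).toMonoidHom ↔ g⁻¹ * x * g ∈ Q := by
  rw [Subgroup.mem_map_equiv, MulAut.conj_symm_apply]

theorem mem_normalizer_map_conj {Q : Subgroup G} {g x : G} :
    x ∈ Subgroup.normalizer (Q.map (MulAut.conj g).toMonoidHom : Set G) ↔
      g⁻¹ * x * g ∈ Subgroup.normalizer (Q : Set G) := by
  simp only [Subgroup.mem_normalizer_iff, mem_map_conj]
  constructor
  · intro h y
    have := h (g * y * g⁻¹)
    simpa [mul_assoc] using this
  · intro h y
    have := h (g⁻¹ * y * g)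
    simpa [mul_assoc] using this

theorem chainNormalizer_conj {S : Subgroup G} {T : Set (Subgroup G)} {s : G} (hs : s ∈ S) :
    chainNormalizer S ((fun Q => Q.map (MulAut.conj s).toMonoidHom) '' T) =
      (chainNormalizer S T).map (MulAut.conj s).toMonoidHom := by
  ext x
  rw [mem_map_conj, mem_chainNormalizer, mem_chainNormalizer]
  refine and_congr ?_ ?_
  · rw [S.mul_mem_cancel_right hs, S.mul_mem_cancel_left (S.inv_mem hs)]
  · rw [Set.forall_mem_image]
    exact forall₂_congr fun Q _ => mem_normalizer_map_conj

theorem mem_normalizer_of_map_conj_eq {Q : Subgroup G} {g : G}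
    (h : Q.map (MulAut.conj g).toMonoidHom = Q) : g ∈ Subgroup.normalizer (Q : Set G) := by
  rw [Subgroup.mem_normalizer_iff]
  intro x
  conv_rhs => rw [← h, mem_map_conj]
  simp [mul_assoc]

/-- A conjugate of `Q` lying in the same chain is comparable with `Q` and has the same order, so
equals `Q`. -/
theorem mem_chainNormalizer_of_image_eq [Finite G] {S : Subgroup G} {T : Set (Subgroup G)}
    (hT : ∀ Q ∈ T, ∀ Q' ∈ T, Q ≤ Q' ∨ Q' ≤ Q) {s : G} (hs : s ∈ S)
    (h : (fun Q => Q.map (MulAut.conj s).toMonoidHom) '' T = T) : s ∈ chainNormalizer S T := by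
  refine mem_chainNormalizer.mpr ⟨hs, fun Q hQ => mem_normalizer_of_map_conj_eq ?_⟩
  have hmem : Q.map (MulAut.conj s).toMonoidHom ∈ T := by
    have := Set.mem_image_of_mem (fun Q => Q.map (MulAut.conj s).toMonoidHom) hQ
    rwa [h] at this
  have hcard : Nat.card (Q.map (MulAut.conj s).toMonoidHom) = Nat.card Q :=
    Nat.card_congr (Q.equivMapOfInjective _ (MulAut.conj s).injective).symm.toEquiv
  rcases hT _ hQ _ hmem with h1 | h1
  · exact (Subgroup.eq_of_le_of_card_ge h1 hcard.le).symm
  · exact Subgroup.eq_of_le_of_card_ge h1 hcard.ge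

/-- The first factor normalizes `Q`, so the join is a product of two `p`-groups one of which
normalizes the other. -/
theorem isPGroup_chainNormalizer_sup {p : ℕ} {S Q : Subgroup G} {T : Set (Subgroup G)}
    (hS : IsPGroup p S) (hQ : IsPGroup p Q) (hQT : Q ∈ T) :
    IsPGroup p (chainNormalizer S T ⊔ Q : Subgroup G) :=
  (hS.to_le inf_le_left).to_sup_of_normal_right' hQ fun _ hg => (mem_chainNormalizer.mp hg).2 Q hQT

/-- A `p`-group acting on a nontrivial `p`-group centralizes a nontrivial subgroup. -/
theorem inf_centralizer_ne_bot [Finite G] {p : ℕ} [Fact p.Prime] {N Q : Subgroup G}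
    (hN : IsPGroup p N) (hQ : IsPGroup p Q) (hNQ : N ≤ Subgroup.normalizer (Q : Set G))
    (hne : Q ≠ ⊥) : Q ⊓ Subgroup.centralizer (N : Set G) ≠ ⊥ := by
  let _ : MulAction N Q :=
    MulAction.compHom Q (Q.normalizerMonoidHom.comp (Subgroup.inclusion hNQ))
  have hsmul : ∀ (n : N) (q : Q), ((n • q : Q) : G) = n * q * (n : G)⁻¹ := fun _ _ => rfl
  have hdvd : p ∣ Nat.card Q := hQ.card_eq_or_dvd.resolve_left fun h =>
    hne (Subgroup.card_eq_one.mp h)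
  -- The number of fixed points is congruent to the order of `Q`, hence to `0`, modulo `p`; as `1`
  -- is fixed, there is another fixed point.
  obtain ⟨q, hq, hq1⟩ := hN.exists_fixed_point_of_prime_dvd_card_of_fixed_point Q hdvd (a := 1)
    fun n => Subtype.ext (by rw [hsmul]; simp)
  intro h
  have hmem : (q : G) ∈ Q ⊓ Subgroup.centralizer (N : Set G) := by
    refine ⟨q.2, Subgroup.mem_centralizer_iff.mpr fun n hn => ?_⟩
    have := congrArg Subtype.val (hq ⟨n, hn⟩)
    rw [hsmul] at this
    exact mul_inv_eq_iff_eq_mul.mp this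
  rw [h, Subgroup.mem_bot] at hmem
  exact hq1 (Subtype.ext hmem.symm)

theorem map_conj_centralizer (N : Subgroup G) (g : G) :
    (Subgroup.centralizer (N : Set G)).map (MulAut.conj g).toMonoidHom =
      Subgroup.centralizer (N.map (MulAut.conj g).toMonoidHom : Set G) := by
  ext x
  simp only [mem_map_conj, Subgroup.mem_centralizer_iff, SetLike.mem_coe]
  constructor
  · intro h y hy
    have := h _ hy
    calc y * x = g * ((g⁻¹ * y * g) * (g⁻¹ * x * g)) * g⁻¹ := by group
      _ = g * ((g⁻¹ * x * g) * (g⁻¹ * y * g)) * g⁻¹ := by rw [this]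
      _ = x * y := by group
  · intro h y hy
    have := h (g * y * g⁻¹) (by simpa [mul_assoc] using hy)
    calc y * (g⁻¹ * x * g) = g⁻¹ * ((g * y * g⁻¹) * x) * g := by group
      _ = g⁻¹ * (x * (g * y * g⁻¹)) * g := by rw [this]
      _ = g⁻¹ * x * g * y := by group

end ChainNormalizer

/-! ### Lifting through fixed preimages of stabilizers -/

section StabilizerCriterion

theorem StrictAction.act_one_obj {G : Type*} [Group G] {A : Type u} [Category.{v} A]
    [StrictAction G A] (x : A) : (act (1 : G)).obj x = x := by
  rw [act_one]
  rfl

theorem StrictAction.act_mul_obj {G : Type*} [Group G] {A : Type u} [Category.{v} A]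
    [StrictAction G A] (g h : G) (x : A) : (act (g * h)).obj x = (act g).obj ((act h).obj x) := by
  rw [act_mul]
  rfl

variable {B : Type*} [PartialOrder B] [Fintype B]

/-- A version of `isEquivariantHomotopyEquiv_of_chains` in which chains of the target are sent to
objects of the target having preimages that are fixed by the stabilizer of the chain. -/
theorem isEquivariantHomotopyEquiv_of_stabilizers {G : Type*} [Group G] (S : Subgroup G)
    {A A' : Type u} [Category.{u} A] [Quiver.IsThin A] [StrictAction G A] [Category.{u} A']
    [Quiver.IsThin A'] [StrictAction G A'] (F : A ⥤ A') (ε : Bool) (i : A' → B)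
    (hi : ∀ x y, orient ε HasArrow x y ↔ i x ≤ i y)
    (hiF : ∀ x y, orient ε HasArrow x y ↔ i (F.obj x) ≤ i (F.obj y)) (γ : S → B ≃o B)
    (hγ1 : ∀ b, γ 1 b = b) (hγmul : ∀ s t b, γ (s * t) b = γ s (γ t b))
    (hγ : ∀ (s : S) x, i ((StrictAction.act (A := A') (s : G)).obj x) = γ s (i x))
    (hF : ∀ (s : S) x, F.obj ((StrictAction.act (A := A) (s : G)).obj x) =
      (StrictAction.act (A := A') (s : G)).obj (F.obj x))
    (d : ChainSet B → A')
    (hdγ : ∀ (s : S) τ, d (τ.map (γ s)) = (StrictAction.act (A := A') (s : G)).obj (d τ))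
    (hd : ∀ τ τ' : ChainSet B, τ'.1 ⊆ τ.1 → i (d τ) ≤ i (d τ'))
    (hbot : ∀ τ, τ.bot ≤ i (d τ))
    (hex : ∀ τ, ∃ x, F.obj x = d τ ∧ ∀ s : S, τ.map (γ s) = τ →
      (StrictAction.act (A := A) (s : G)).obj x = x) :
    IsEquivariantHomotopyEquiv S (nerveSpaceMap F) := by
  let _ : MulAction S (ChainSet B) :=
    { smul := fun s τ => τ.map (γ s)
      one_smul := fun τ => by
        have : γ 1 = OrderIso.refl B := OrderIso.ext (funext hγ1)
        change τ.map (γ 1) = τ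
        rw [this, ChainSet.map_refl]
      mul_smul := fun s t τ => by
        refine ChainSet.ext ?_
        change τ.1.map (γ (s * t)).toEquiv.toEmbedding =
          (τ.1.map (γ t).toEquiv.toEmbedding).map (γ s).toEquiv.toEmbedding
        rw [Finset.map_map]
        congr 1
        ext b
        exact hγmul s t b }
  let _ : MulAction S A :=
    { smul := fun s x => (StrictAction.act (A := A) (s : G)).obj x
      one_smul := fun x => StrictAction.act_one_obj x
      mul_smul := fun s t x => StrictAction.act_mul_obj (s : G) (t : G) x }
  obtain ⟨c, hc, hcγ⟩ := exists_equivariant_section (K := S) (T := ChainSet B) (X := A)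
    (P := fun τ x => F.obj x = d τ)
    (fun s τ x h => ((hF s x).trans (by rw [h])).trans (hdγ s τ).symm) hex
  refine isEquivariantHomotopyEquiv_of_chains S F ε i hi hiF γ hγ hF c hcγ (fun τ τ' h => ?_)
    (fun τ => ?_)
  · rw [hc, hc]
    exact hd τ τ' h
  · rw [hc]
    exact hbot τ

end StabilizerCriterion

/-! ### Application to the orbit and subgroup categories -/

namespace SubgroupCollection

variable {G : Type u} [Group G] (C : SubgroupCollection G)

instance : Quiver.IsThin C.EO := fun _ _ => inferInstance
instance : Quiver.IsThin C.EA := fun _ _ => inferInstance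
instance : Quiver.IsThin C.EAConj := fun _ _ => inferInstance

/-- Conjugation as an automorphism of the poset of members of a collection. -/
def conjIso (g : G) : C.Elem ≃o C.Elem where
  toFun := (StrictAction.act (A := C.Elem) g).obj
  invFun := (StrictAction.act (A := C.Elem) g⁻¹).obj
  left_inv Q := by rw [← StrictAction.act_mul_obj, inv_mul_cancel, StrictAction.act_one_obj]
  right_inv Q := by rw [← StrictAction.act_mul_obj, mul_inv_cancel, StrictAction.act_one_obj]
  map_rel_iff' := Subgroup.map_le_map_iff_of_injective (MulAut.conj g).injective

theorem coe_conjIso (g : G) (Q : C.Elem) :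
    (C.conjIso g Q).1 = Q.1.map (MulAut.conj g).toMonoidHom := rfl

theorem conjIso_one (Q : C.Elem) : C.conjIso 1 Q = Q :=
  StrictAction.act_one_obj (G := G) (A := C.Elem) Q

theorem conjIso_mul (g h : G) (Q : C.Elem) : C.conjIso (g * h) Q = C.conjIso g (C.conjIso h Q) :=
  StrictAction.act_mul_obj (A := C.Elem) g h Q

theorem hasArrow_elem_iff {Q Q' : C.Elem} : HasArrow Q Q' ↔ Q ≤ Q' :=
  ⟨fun ⟨f⟩ => leOfHom f, fun h => ⟨homOfLE h⟩⟩

/-- By transitivity a `G`-map is determined by sending `X.pt` to `Y.pt`, and it is well defined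
exactly when the stabilizer of `X.pt` fixes `Y.pt`. -/
theorem hasArrow_eo_iff {X Y : C.EO} : HasArrow X Y ↔ C.eoFunctor.obj X ≤ C.eoFunctor.obj Y := by
  refine ⟨fun ⟨f⟩ => leOfHom (C.eoFunctor.map f), fun h => ?_⟩
  have hstab : ∀ k : G, k • X.pt = X.pt → k • Y.pt = Y.pt := fun k hk => h hk
  have hwd : ∀ k k' : G, k • X.pt = k' • X.pt → k • Y.pt = k' • Y.pt := fun k k' hk => by
    rw [← inv_smul_eq_iff, ← mul_smul] at hk ⊢
    exact hstab _ hk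
  choose k hk using fun z : G ⧸ X.sub => MulAction.exists_smul_eq G X.pt z
  exact ⟨⟨⟨fun z => k z • Y.pt, fun m z => by
    change k (m • z) • Y.pt = m • k z • Y.pt
    rw [← mul_smul]
    exact hwd _ _ (by rw [hk, mul_smul, hk])⟩, hstab _ (hk X.pt)⟩⟩

/-- When the images are nested, inverting `Y.mono` on its range gives the factorization. -/
theorem hasArrow_ea_iff {X Y : C.EA} : HasArrow X Y ↔ C.eaFunctor.obj X ≤ C.eaFunctor.obj Y := by
  refine ⟨fun ⟨f⟩ => leOfHom (C.eaFunctor.map f), fun h => ?_⟩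
  have h' : X.mono.range ≤ Y.mono.range := h
  let e := MonoidHom.ofInjective Y.injective
  refine ⟨⟨e.symm.toMonoidHom.comp ((Subgroup.inclusion h').comp X.mono.rangeRestrict), ?_⟩⟩
  ext z
  have : e (e.symm (Subgroup.inclusion h' (X.mono.rangeRestrict z))) =
    Subgroup.inclusion h' (X.mono.rangeRestrict z) := e.apply_symm_apply _
  exact congrArg Subtype.val this

theorem hasArrow_eaConj_iff {X Y : C.EAConj} :
    HasArrow X Y ↔ C.eaConjFunctor.obj X ≤ C.eaConjFunctor.obj Y := by
  refine ⟨fun ⟨f⟩ => leOfHom (C.eaConjFunctor.map f), fun h => ?_⟩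
  obtain ⟨f⟩ := C.hasArrow_ea_iff.mpr (show C.eaFunctor.obj X.obj ≤ C.eaFunctor.obj Y.obj from h)
  exact ⟨ObjectProperty.homMk f⟩

theorem eoFunctor_act (g : G) (X : C.EO) :
    C.eoFunctor.obj ((StrictAction.act (A := C.EO) g).obj X) =
      (StrictAction.act (A := C.Elem) g).obj (C.eoFunctor.obj X) :=
  Subtype.ext (MulAction.stabilizer_smul_eq_stabilizer_map_conj g X.pt)

theorem eaFunctor_act (g : G) (X : C.EA) :
    C.eaFunctor.obj ((StrictAction.act (A := C.EA) g).obj X) =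
      (StrictAction.act (A := C.Elem) g).obj (C.eaFunctor.obj X) :=
  Subtype.ext (MonoidHom.range_comp _ _)

theorem isEquivariantHomotopyEquiv_eoFunctor [Finite G] {p : ℕ} {S : Subgroup G}
    (hS : IsPGroup p S) (hC : ∀ Q ∈ C.carrier, IsPGroup p Q)
    (hover : ∀ Q P : Subgroup G, Q ∈ C.carrier → Q ≤ P → IsPGroup p P → P ∈ C.carrier) :
    IsEquivariantHomotopyEquiv S (nerveSpaceMap C.eoFunctor) := by
  let _ : Fintype C.Elem := Fintype.ofFinite _
  let T : ChainSet C.Elem → Set (Subgroup G) := fun τ => (fun Q => Q.1) '' (τ.1 : Set C.Elem)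
  have hT : ∀ (s : S) τ, T (τ.map (C.conjIso s)) =
      (fun Q => Q.map (MulAut.conj (s : G)).toMonoidHom) '' T τ := fun s τ => by
    simp only [T, ChainSet.map, Finset.coe_map, Set.image_image]
    rfl
  -- The join is the product `N_S(τ)·Q` with `Q` the least member; joining `N_S(τ)` is what makes
  -- the trivial coset fixed by the stabilizer of `τ`.
  let d : ChainSet C.Elem → C.Elem := fun τ => ⟨chainNormalizer S (T τ) ⊔ τ.bot.1,
    hover _ _ τ.bot.2 le_sup_right
      (isPGroup_chainNormalizer_sup hS (hC _ τ.bot.2) ⟨_, τ.bot_mem, rfl⟩)⟩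
  refine isEquivariantHomotopyEquiv_of_stabilizers S C.eoFunctor false id
    (fun _ _ => C.hasArrow_elem_iff) (fun _ _ => C.hasArrow_eo_iff) (fun s => C.conjIso (s : G))
    C.conjIso_one (fun s t => C.conjIso_mul s t) (fun _ _ => rfl) (fun s => C.eoFunctor_act s) d
    (fun s τ => Subtype.ext ?_) (fun τ τ' h => ?_) (fun τ => ?_) (fun τ => ?_)
  · change chainNormalizer S (T (τ.map (C.conjIso s))) ⊔ (τ.map (C.conjIso s)).bot.1 =
      (chainNormalizer S (T τ) ⊔ τ.bot.1).map (MulAut.conj (s : G)).toMonoidHom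
    rw [Subgroup.map_sup, hT, chainNormalizer_conj s.2, ChainSet.bot_map, coe_conjIso]
  · exact sup_le_sup (chainNormalizer_anti S (Set.image_mono h)) (ChainSet.bot_le_bot h)
  · exact Subtype.coe_le_coe.mp le_sup_right
  · refine ⟨⟨(d τ).1, (d τ).2, ((1 : G) : G ⧸ (d τ).1)⟩,
      Subtype.ext (MulAction.stabilizer_quotient _), fun s hs => ?_⟩
    have hmem : (s : G) ∈ (d τ).1 := by
      refine Subgroup.mem_sup_left (mem_chainNormalizer_of_image_eq ?_ s.2 ?_)
      · rintro _ ⟨Q, hQ, rfl⟩ _ ⟨Q', hQ', rfl⟩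
        exact τ.2.2.total hQ hQ'
      · rw [← hT, hs]
    have hpt : (s : G) • ((1 : G) : G ⧸ (d τ).1) = ((1 : G) : G ⧸ (d τ).1) := by
      rw [← MulAction.mem_stabilizer_iff, MulAction.stabilizer_quotient]
      exact hmem
    exact congrArg (EO.mk (d τ).1 (d τ).2) hpt

/-- The inclusion of a member of a collection, as an object of `EA_C`. -/
def inclusionObj (Q : C.Elem) : C.EA :=
  ⟨Q.1, Q.2, Q.1.subtype, Q.1.subtype_injective, by rw [Subgroup.range_subtype]; exact Q.2⟩

theorem eaFunctor_inclusionObj (Q : C.Elem) : C.eaFunctor.obj (C.inclusionObj Q) = Q :=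
  Subtype.ext (Subgroup.range_subtype Q.1)

theorem act_inclusionObj {Q : C.Elem} {g : G} (h : ∀ x ∈ Q.1, g * x = x * g) :
    (StrictAction.act (A := C.EA) g).obj (C.inclusionObj Q) = C.inclusionObj Q := by
  refine EA.mk_congr C (MonoidHom.ext fun x => ?_)
  change g * (x : G) * g⁻¹ = x
  rw [h x.1 x.2, mul_inv_cancel_right]

/-- The criterion for functors to a collection that is closed under nontrivial subgroups. -/
theorem isEquivariantHomotopyEquiv_of_centralizers [Finite G] {p : ℕ} [Fact p.Prime]
    {S : Subgroup G} (hS : IsPGroup p S) (hC : ∀ Q ∈ C.carrier, IsPGroup p Q)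
    (hunder : ∀ Q P : Subgroup G, Q ∈ C.carrier → P ≤ Q → P ≠ ⊥ → P ∈ C.carrier)
    {A : Type u} [Category.{u} A] [Quiver.IsThin A] [StrictAction G A] (F : A ⥤ C.Elem)
    (harrow : ∀ X Y, HasArrow X Y ↔ F.obj X ≤ F.obj Y)
    (hact : ∀ (g : G) X, F.obj ((StrictAction.act (A := A) g).obj X) =
      (StrictAction.act (A := C.Elem) g).obj (F.obj X))
    (hlift : ∀ Q : C.Elem, ∃ X, F.obj X = Q ∧ ∀ g : G, (∀ x ∈ Q.1, g * x = x * g) →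
      (StrictAction.act (A := A) g).obj X = X) :
    IsEquivariantHomotopyEquiv S (nerveSpaceMap F) := by
  -- In the dual order `bot` is the largest subgroup of the chain, and `d τ` has to lie below it in
  -- `C`.
  let _ : Fintype C.Elemᵒᵈ := Fintype.ofFinite _
  let T : ChainSet C.Elemᵒᵈ → Set (Subgroup G) := fun τ =>
    (fun Q => (OrderDual.ofDual Q).1) '' (τ.1 : Set C.Elemᵒᵈ)
  have hT : ∀ (s : S) τ, T (τ.map (C.conjIso s).dual) =
      (fun Q => Q.map (MulAut.conj (s : G)).toMonoidHom) '' T τ := fun s τ => by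
    simp only [T, ChainSet.map, Finset.coe_map, Set.image_image]
    rfl
  have hmem : ∀ τ : ChainSet C.Elemᵒᵈ, (OrderDual.ofDual τ.bot).1 ⊓
      Subgroup.centralizer (chainNormalizer S (T τ) : Set G) ∈ C.carrier := fun τ => by
    -- The closure hypothesis gives only nontrivial subgroups. If the largest member is trivial, the
    -- intersection is that member itself.
    by_cases h : (OrderDual.ofDual τ.bot).1 = ⊥
    · rw [h, bot_inf_eq, ← h]
      exact (OrderDual.ofDual τ.bot).2
    · exact hunder _ _ (OrderDual.ofDual τ.bot).2 inf_le_left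
        (inf_centralizer_ne_bot (hS.to_le inf_le_left) (hC _ (OrderDual.ofDual τ.bot).2)
          (fun g hg => (mem_chainNormalizer.mp hg).2 _ ⟨_, τ.bot_mem, rfl⟩) h)
  let d : ChainSet C.Elemᵒᵈ → C.Elem := fun τ => ⟨_, hmem τ⟩
  refine isEquivariantHomotopyEquiv_of_stabilizers S F true OrderDual.toDual
    (fun _ _ => C.hasArrow_elem_iff) (fun _ _ => harrow _ _) (fun s => (C.conjIso (s : G)).dual)
    C.conjIso_one (fun s t => C.conjIso_mul s t) (fun _ _ => rfl) (fun s => hact s) d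
    (fun s τ => Subtype.ext ?_) (fun τ τ' h => ?_) (fun τ => ?_) (fun τ => ?_)
  · change (OrderDual.ofDual (τ.map (C.conjIso s).dual).bot).1 ⊓
      Subgroup.centralizer (chainNormalizer S (T (τ.map (C.conjIso s).dual)) : Set G) =
      ((OrderDual.ofDual τ.bot).1 ⊓ Subgroup.centralizer (chainNormalizer S (T τ) : Set G)).map
        (MulAut.conj (s : G)).toMonoidHom
    rw [Subgroup.map_inf _ _ _ (MulAut.conj (s : G)).injective, hT, chainNormalizer_conj s.2,
      ChainSet.bot_map, map_conj_centralizer]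
    rfl
  · exact inf_le_inf (show (OrderDual.ofDual τ'.bot).1 ≤ (OrderDual.ofDual τ.bot).1 from
      ChainSet.bot_le_bot h) (Subgroup.centralizer_le (chainNormalizer_anti S (Set.image_mono h)))
  · exact show (d τ).1 ≤ (OrderDual.ofDual τ.bot).1 from inf_le_left
  · obtain ⟨X, hX, hfix⟩ := hlift (d τ)
    -- An element stabilizing `τ` lies in `N_S(τ)`, which `d τ` centralizes by construction.
    refine ⟨X, hX, fun s hs => hfix s fun x hx => ?_⟩
    refine Subgroup.mem_centralizer_iff.mp hx.2 s (mem_chainNormalizer_of_image_eq ?_ s.2 ?_)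
    · rintro _ ⟨Q, hQ, rfl⟩ _ ⟨Q', hQ', rfl⟩
      exact (τ.2.2.total hQ hQ').symm
    · rw [← hT, hs]

end SubgroupCollection

theorem lemma2p7 {G : Type u} [Group G] [Finite G] (p : ℕ) [Fact p.Prime] (S : Sylow p G)
    (C : SubgroupCollection G) (hC : ∀ Q ∈ C.carrier, IsPGroup p Q) :
    ((∀ Q P : Subgroup G, Q ∈ C.carrier → Q ≤ P → IsPGroup p P → P ∈ C.carrier) →
      IsEquivariantHomotopyEquiv (S : Subgroup G) (nerveSpaceMap C.eoFunctor)) ∧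
    ((∀ Q P : Subgroup G, Q ∈ C.carrier → P ≤ Q → P ≠ ⊥ → P ∈ C.carrier) →
      IsEquivariantHomotopyEquiv (S : Subgroup G) (nerveSpaceMap C.eaFunctor) ∧
      IsEquivariantHomotopyEquiv (S : Subgroup G) (nerveSpaceMap C.eaConjFunctor)) := by
  refine ⟨C.isEquivariantHomotopyEquiv_eoFunctor S.isPGroup' hC, fun hunder => ⟨?_, ?_⟩⟩
  · exact C.isEquivariantHomotopyEquiv_of_centralizers S.isPGroup' hC hunder C.eaFunctor
      (fun _ _ => C.hasArrow_ea_iff) C.eaFunctor_act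
      fun Q => ⟨C.inclusionObj Q, C.eaFunctor_inclusionObj Q, fun _ h => C.act_inclusionObj h⟩
  · exact C.isEquivariantHomotopyEquiv_of_centralizers S.isPGroup' hC hunder C.eaConjFunctor
      (fun _ _ => C.hasArrow_eaConj_iff) (fun g X => C.eaFunctor_act g X.obj)
      -- Inclusions are induced by conjugation with `1`, so the lift used for `EA_C` already lies in
      -- the full subcategory.
      fun Q => ⟨⟨C.inclusionObj Q, 1, fun h => by
        change (h : G) = 1 * (h : G) * 1⁻¹
        simp⟩, C.eaFunctor_inclusionObj Q,
        fun _ h => ObjectProperty.FullSubcategory.ext (C.act_inclusionObj h)⟩
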